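/- Let $a>\sqrt3$ and $c(a)=\tfrac98\left(a+\tfrac1a\right)$. Let $e_1,e_2,e_3$ be the basis of $su(2)$ with $[e_1,e_2]=e_3$ and cyclically (so $e_j=-\tfrac i2\sigma_j$ with the Pauli matrices $\sigma_j$), with dual left-invariant one-forms $\omega^1,\omega^2,\omega^3$. Consider the left-invariant CR structure on $SU(2)=S^3$ with contact form $\theta=-\omega^3$ and $J e_1=\tfrac1a e_2$, $Je_2=-a e_1$. Its Fefferman metric is the left-invariant Lorentzian metric on $SU(2)\times S^1$ (with angular coordinate $\gamma$ on $S^1$) $$\tfrac1a(\omega^1)^2+a(\omega^2)^2+4\,\theta\odot\sigma,\qquad \sigma=\tfrac13 d\gamma+\tfrac18\left(a+\tfrac1a\right)\theta,\qquad \theta\odot\sigma=\tfrac12(\theta\otimes\sigma+\sigma\otimes\theta).$$ Write covectors as $M_1\omega^1+M_2\omega^2+M_3\omega^3+P\,d\gamma$. The geodesic Hamiltonian is $$H=\tfrac12\left(aM_1^2+\tfrac1aM_2^2-3M_3P-c(a)P^2\right).$$ Consider its light-like solutions $(g(t),\gamma(t),M(t),P)$, i.e. those with $H=0$, with $P=1$.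 The curve $g(t)\in SU(2)$ is a chain. The reduced curve $M(t)$ solves the Lie–Poisson equations and lies on the paraboloid $H(M,1)=0$ and on a sphere $K=M_1^2+M_2^2+M_3^2=\mathrm{const}$. The momentum $L=gMg^{-1}\in su(2)\cong\mathbb R^3$ is constant along the solution, and $|L|=\sqrt K$. Let $m(a)$ be the minimum of $K$ on the paraboloid $H(M,1)=0$, and let $k(a)=c(a)^2/9$ be the value of $K$ on the homoclinic figure eight, i.e. at the equilibrium $M=(0,0,-c(a)/3)$. Then $m(a)<k(a)$, and there are functions $T$, $D$ and $\Delta\theta=\Delta\theta(\cdot,a)$ of $K$ with the following properties. 1. For every $K\in(m(a),k(a))$ there are light-like solutions with $P=1$ on the level $K$. For every such solution: * the reduced curve $M$ is closed, and $T(K)>0$ is its first return time (the time to go once around it); * the chain satisfies $$g(T(K))=\exp\!\left(\delta\,\tfrac{L}{|L|}\right)g(0)\iff \delta\in\Delta\theta(K,a)+4\pi\mathbb Z ,$$ so $\Delta\theta(K,a)$ is the holonomy (rotation angle) of the chain once around the reduced curve, and up to the $4\pi$-periodicity of $\theta\mapsto\exp(\theta L/|L|)$ it depends only on $K$ (and $a$);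 * $D(K)=\dfrac1{\sqrt K}\displaystyle\int_0^{T(K)} f\,dt$ with $f=\tfrac12\left(aM_1^2+\tfrac1aM_2^2+c(a)\right)$, and $$\Delta\theta(K,a)=D(K)-\Omega(K),$$ where $\Omega(K)=\displaystyle\oint\frac{M_1\,dM_2-M_2\,dM_1}{\sqrt K\,(\sqrt K+M_3)}$ is the oriented solid angle of the reduced curve. 2. $K\mapsto\Delta\theta(K,a)$ is continuous on $(m(a),k(a))$. 3. As $K\to k(a)$ from below, $T(K)\to+\infty$, $D(K)\to+\infty$ and $\Delta\theta(K,a)\to+\infty$. 4. $K\mapsto\Delta\theta(K,a)$ is not constant on $(m(a),k(a))$, even modulo $2\pi$: there are $K_1,K_2\in(m(a),k(a))$ with $\Delta\theta(K_1,a)-\Delta\theta(K_2,a)\notin2\pi\mathbb Z$. -/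

import Mathlib

open scoped Matrix Topology

namespace ChainsSU2

noncomputable section

/-- The group `SU(2) = S³`. -/
abbrev SU2 : Type := Matrix.specialUnitaryGroup (Fin 2) ℂ

/-- The standard basis `e₁, e₂, e₃` of `su(2)`, namely `-(i/2)` times the Pauli matrices, so that
`[e₁, e₂] = e₃` and cyclically; for the dual left-invariant forms, `dω³ = - ω¹ ∧ ω²` and
cyclically. -/
def basisSu2 : Fin 3 → Matrix (Fin 2) (Fin 2) ℂ :=
  ![!![0, -Complex.I / 2; -Complex.I / 2, 0],
    !![0, -1 / 2; 1 / 2, 0],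
    !![-Complex.I / 2, 0; 0, Complex.I / 2]]

/-- The element `v₁ e₁ + v₂ e₂ + v₃ e₃` of `su(2)`.  It is also used to identify `su(2)*`, with
coordinates `M₁, M₂, M₃` in the dual basis, with `su(2)`. -/
def toSu2 (v : Fin 3 → ℝ) : Matrix (Fin 2) (Fin 2) ℂ := ∑ i, v i • basisSu2 i

/-! Left-invariant covectors on `SU(2) × S¹` are written in the basis `ω¹, ω², ω³, dγ`. -/

/-- The contact form `θ = - ω³`. -/
def contactForm : Fin 4 → ℝ := ![0, 0, -1, 0]

/-- The Levi form `(1/a) (ω¹)² + a (ω²)²` of the CR structure `J e₁ = (1/a) e₂`, `J e₂ = - a e₁`,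
extended by zero on the Reeb field and pulled back to `SU(2) × S¹`. -/
def leviForm (a : ℝ) : Matrix (Fin 4) (Fin 4) ℝ := Matrix.diagonal ![1 / a, a, 0, 0]

/-- The form `σ = dγ / 3 + (1/8) (a + 1/a) θ`. -/
def sigmaForm (a : ℝ) : Fin 4 → ℝ := ![0, 0, 0, 1 / 3] + ((a + 1 / a) / 8) • contactForm

/-- The left-invariant Fefferman metric `L_θ + 4 θ ⊙ σ` on `SU(2) × S¹`, where
`θ ⊙ σ = (θ ⊗ σ + σ ⊗ θ) / 2`, as its Gram matrix in the frame `e₁, e₂, e₃, ∂/∂γ`. -/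
def feffermanMetric (a : ℝ) : Matrix (Fin 4) (Fin 4) ℝ :=
  leviForm a + (4 : ℝ) • ((1 / 2 : ℝ) •
    (Matrix.vecMulVec contactForm (sigmaForm a) + Matrix.vecMulVec (sigmaForm a) contactForm))

/-- The covector `M₁ ω¹ + M₂ ω² + M₃ ω³ + P dγ`. -/
def covector (M : Fin 3 → ℝ) (P : ℝ) : Fin 4 → ℝ := ![M 0, M 1, M 2, P]

/-- The Hamiltonian `H = (1/2) ∑ g^{ij} p_i p_j` of the Fefferman metric. -/
def hamiltonian (a : ℝ) (M : Fin 3 → ℝ) (P : ℝ) : ℝ :=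
  (1 / 2) * (covector M P ⬝ᵥ ((feffermanMetric a)⁻¹ *ᵥ covector M P))

/-- The velocity `∂H/∂p`, i.e. the covector with its index raised. -/
def velocity (a : ℝ) (M : Fin 3 → ℝ) (P : ℝ) : Fin 4 → ℝ :=
  (feffermanMetric a)⁻¹ *ᵥ covector M P

/-- The `su(2)` part `(∂H/∂M₁, ∂H/∂M₂, ∂H/∂M₃)` of the velocity. -/
def angularVelocity (a : ℝ) (M : Fin 3 → ℝ) (P : ℝ) : Fin 3 → ℝ :=
  ![velocity a M P 0, velocity a M P 1, velocity a M P 2]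

/-- The Casimir `K = M₁² + M₂² + M₃²`. -/
def casimir (M : Fin 3 → ℝ) : ℝ := M 0 ^ 2 + M 1 ^ 2 + M 2 ^ 2

/-- `(g, γ, M, P)` is an integral curve, in the left trivialization of `T*(SU(2) × S¹)`, of the
Hamiltonian flow of the Fefferman metric; it is light-like, with `P = 1`, and `M` starts on the
level `K` of the Casimir.  The coordinate on `S¹` is lifted to `ℝ`.  The curve `g` is a chain and
`M` is its reduced curve.  The equation for `M` is the Lie-Poisson equation
`dM_i/dt = {M_i, H}` with `{M₁, M₂} = - M₃` and cyclically. -/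
structure IsLightlikeGeodesic (a K : ℝ) (g : ℝ → SU2) (γ : ℝ → ℝ) (M : ℝ → Fin 3 → ℝ)
    (P : ℝ → ℝ) : Prop where
  deriv_g : ∀ (t : ℝ) (i j : Fin 2),
    HasDerivAt (fun s : ℝ => (g s : Matrix (Fin 2) (Fin 2) ℂ) i j)
      (((g t : Matrix (Fin 2) (Fin 2) ℂ) * toSu2 (angularVelocity a (M t) (P t))) i j) t
  deriv_gamma : ∀ t : ℝ, HasDerivAt γ (velocity a (M t) (P t) 3) t
  deriv_M : ∀ t : ℝ, HasDerivAt M (M t ⨯₃ angularVelocity a (M t) (P t)) t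
  deriv_P : ∀ t : ℝ, HasDerivAt P 0 t
  lightlike : ∀ t : ℝ, hamiltonian a (M t) (P t) = 0
  P_eq_one : P 0 = 1
  casimir_eq : casimir (M 0) = K

/-- The value at `(g, M)` of the momentum map of the left action of `SU(2)`, as an element
`g M g⁻¹` of `su(2)`. -/
def momentumMap (g : SU2) (M : Fin 3 → ℝ) : Matrix (Fin 2) (Fin 2) ℂ :=
  (g : Matrix (Fin 2) (Fin 2) ℂ) * toSu2 M * ((g⁻¹ : SU2) : Matrix (Fin 2) (Fin 2) ℂ)

/-- After time `T` the chain `g` with reduced curve `M` has been translated by the angle `δ` along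
the circle `exp(δ L / |L|)`, where `L` is its momentum: `g(T) = exp(δ L / |L|) g(0)`.  For
`L = r e₃` with `r > 0` this reads `g(T) = exp(δ e₃) g(0)`. -/
def IsHolonomy (g : ℝ → SU2) (M : ℝ → Fin 3 → ℝ) (T δ : ℝ) : Prop :=
  (g T : Matrix (Fin 2) (Fin 2) ℂ) =
    NormedSpace.exp ((δ / √(casimir (M 0))) • momentumMap (g 0) (M 0)) *
      (g 0 : Matrix (Fin 2) (Fin 2) ℂ)

/-- The constant `c(a) = (9/8) (a + 1/a)`, for which
`H(M, 1) = (1/2) (a M₁² + M₂² / a - 3 M₃ - c(a))`. -/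
def cConst (a : ℝ) : ℝ := 9 / 8 * (a + 1 / a)

/-- The minimum of the Casimir on the paraboloid `H(M, 1) = 0`. -/
def minLevel (a : ℝ) : ℝ := sInf (casimir '' {M | hamiltonian a M 1 = 0})

/-- The value of the Casimir on the homoclinic figure eight, i.e. at the equilibrium
`M = (0, 0, - c(a) / 3)` of the reduced dynamics on the paraboloid `H(M, 1) = 0`. -/
def figureEightLevel (a : ℝ) : ℝ := casimir ![0, 0, -cConst a / 3]

/-- The dynamic term `(1 / √K) ∫₀ᵀ f dt`, where `f = (1/2) (a M₁² + M₂² / a + c(a))`. -/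
def dynamicTerm (a K : ℝ) (M : ℝ → Fin 3 → ℝ) (T : ℝ) : ℝ :=
  (1 / √K) * ∫ t in (0 : ℝ)..T, (1 / 2) * (a * M t 0 ^ 2 + M t 1 ^ 2 / a + cConst a)

/-- The oriented solid angle of a closed curve `M : [0, T] → ℝ³` on the sphere of radius `r` that
avoids the south pole `(0, 0, -r)`: the integral of
`(M₁ dM₂ - M₂ dM₁) / (r (r + M₃)) = (1 - cos ϑ) dφ`, which is the primitive, smooth away from the
south pole, of the area form `sin ϑ dϑ ∧ dφ` of the unit sphere, oriented outwards. -/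
def solidAngle (r : ℝ) (M : ℝ → Fin 3 → ℝ) (T : ℝ) : ℝ :=
  ∫ t in (0 : ℝ)..T,
    (M t 0 * deriv (fun s => M s 1) t - M t 1 * deriv (fun s => M s 0) t) / (r * (r + M t 2))

end

end ChainsSU2

namespace ChainsSU2

/-! ### The Hamiltonian in coordinates -/

/-! Reduced dynamics. Eliminating `M₁²` by the light-like condition gives `K - m(a) = (M₃ + 3/(2a))²
+ (1 - 1/a²) M₂²`, an ellipse in the `(M₃, M₂)`-plane. Its angle `φ`, with `M₃ = -3/(2a) + ρ cos φ`
and `ρ = √(K - m(a))`, serves as a phase: `φ' = √(speedSq a ρ φ)`, and `speedSq` is `(a² - 1) M₁²`.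
It is positive as long as `ρ < maxAmplitude a`, which means `K < k(a)`. So every reduced curve runs
monotonically around a closed curve, and the return time and all time integrals of functions of `M₃`
become integrals over a fixed period of `φ` (`IsReducedCurve.exists_phase`,
`IsReducedCurve.integral_eq`).

Reconstruction. An explicit unitary frame `U` carries `e₃` to `M/√K`; its free phase `ψ` is chosen
so that `U' = -X U`, where `X` is the angular velocity in `su(2)`. This forces `ψ' = w(M₃)` with
`w(z) = 3/2 + (c(a) - 3√K)/(√K + z)`. Since `g' = g X`, the product `g U` is constant. When `M`
closes up, `U` differs from its initial value only by its phase, so the chain has turned about its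
momentum by `∫ w dt` (`IsLightlikeGeodesic.isHolonomy_iff`). Pointwise, `w` is the dynamic integrand
minus the solid angle integrand (`IsReducedCurve.rotationSpeed_eq`).

Divergence. Below the figure eight `√K < c(a)/3`, hence `w ≥ 3/2` and `Δθ ≥ (3/2) T`, with no
separate estimate of the solid angle; likewise `D ≥ (3/2) T`. Near `φ = π` the phase speed is
dominated by an affine function whose constant term vanishes as `K → k(a)`, so `T` diverges at least
logarithmically (`log_le_returnTime`). A continuous `Δθ` that tends to infinity cannot be constant
modulo `2π`. -/

theorem inv_feffermanMetric {a : ℝ} (ha : a ≠ 0) :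
    (feffermanMetric a)⁻¹ =
      !![a, 0, 0, 0; 0, 1 / a, 0, 0; 0, 0, 0, -3 / 2; 0, 0, -3 / 2, -cConst a] := by
  apply Matrix.inv_eq_right_inv
  ext i j
  fin_cases i <;> fin_cases j <;>
    simp [feffermanMetric, leviForm, sigmaForm, contactForm, Matrix.mul_apply, Fin.sum_univ_four,
      Matrix.vecMulVec, cConst, ha] <;> ring

theorem velocity_eq {a : ℝ} (ha : a ≠ 0) (M : Fin 3 → ℝ) (P : ℝ) :
    velocity a M P = ![a * M 0, M 1 / a, -3 / 2 * P, -3 / 2 * M 2 - cConst a * P] := by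
  rw [velocity, inv_feffermanMetric ha]
  ext i
  fin_cases i <;> simp [covector, Matrix.mulVec, dotProduct, Fin.sum_univ_four] <;> ring

theorem hamiltonian_eq {a : ℝ} (ha : a ≠ 0) (M : Fin 3 → ℝ) (P : ℝ) :
    hamiltonian a M P =
      1 / 2 * (a * M 0 ^ 2 + M 1 ^ 2 / a - 3 * M 2 * P - cConst a * P ^ 2) := by
  rw [hamiltonian, inv_feffermanMetric ha]
  simp [covector, Matrix.mulVec, dotProduct, Fin.sum_univ_four]
  ring

theorem angularVelocity_eq {a : ℝ} (ha : a ≠ 0) (M : Fin 3 → ℝ) (P : ℝ) :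
    angularVelocity a M P = ![a * M 0, M 1 / a, -3 / 2 * P] := by
  rw [angularVelocity, velocity_eq ha]
  simp

theorem pos_of_sqrt_three_lt {a : ℝ} (ha : √3 < a) : 0 < a :=
  (Real.sqrt_nonneg 3).trans_lt ha

theorem three_lt_sq {a : ℝ} (ha : √3 < a) : 3 < a ^ 2 :=
  (Real.sqrt_lt' (pos_of_sqrt_three_lt ha)).1 ha

theorem sqrt_sq_sub_one_pos {a : ℝ} (ha : √3 < a) : 0 < √(a ^ 2 - 1) :=
  Real.sqrt_pos.2 (by linarith [three_lt_sq ha])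

theorem cConst_pos {a : ℝ} (ha : 0 < a) : 0 < cConst a := by
  unfold cConst; positivity

/-! ### The levels of the Casimir -/

/-- On the paraboloid, `K` is the sum of its minimum and a nonnegative form. -/
theorem casimir_eq_of_lightlike {a : ℝ} (ha : a ≠ 0) {M : Fin 3 → ℝ}
    (h : hamiltonian a M 1 = 0) :
    casimir M = 9 / 8 * (1 - 1 / a ^ 2) + (M 2 + 3 / (2 * a)) ^ 2 +
      (1 - 1 / a ^ 2) * M 1 ^ 2 := by
  rw [hamiltonian_eq ha] at h
  have h0 : M 0 ^ 2 = (3 * M 2 + cConst a - M 1 ^ 2 / a) / a := by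
    rw [eq_div_iff ha]; linarith
  rw [casimir, h0, cConst]
  field_simp
  ring

theorem minLevel_eq {a : ℝ} (ha : √3 < a) : minLevel a = 9 / 8 * (1 - 1 / a ^ 2) := by
  have ha0 := pos_of_sqrt_three_lt ha
  have h3 := three_lt_sq ha
  have hinv : 1 / a ^ 2 < 1 := by rw [div_lt_one (by positivity)]; linarith
  have hx : 0 ≤ 9 / 8 * (1 - 3 / a ^ 2) := by
    have : 3 / a ^ 2 < 1 := by rw [div_lt_one (by positivity)]; linarith
    linarith
  -- The minimizer: both squares in `casimir_eq_of_lightlike` vanish, and the paraboloid then forces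
  -- `M₁² = (9/8)(1 - 3/a²)`, which is nonnegative because `a² > 3`.
  have hp : hamiltonian a ![√(9 / 8 * (1 - 3 / a ^ 2)), 0, -3 / (2 * a)] 1 = 0 := by
    rw [hamiltonian_eq ha0.ne']
    simp only [Matrix.cons_val, Real.sq_sqrt hx, cConst]
    field_simp
    ring
  refine IsLeast.csInf_eq ⟨⟨_, hp, ?_⟩, ?_⟩
  · rw [casimir_eq_of_lightlike ha0.ne' hp]
    simp only [Matrix.cons_val]
    ring
  · rintro _ ⟨M, hM, rfl⟩
    rw [casimir_eq_of_lightlike ha0.ne' hM]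
    nlinarith [sq_nonneg (M 2 + 3 / (2 * a)), mul_nonneg (sub_nonneg.2 hinv.le) (sq_nonneg (M 1))]

theorem figureEightLevel_eq (a : ℝ) : figureEightLevel a = (cConst a / 3) ^ 2 := by
  simp [figureEightLevel, casimir]; ring

/-- The largest amplitude of `M₃` on the levels of the Casimir below the figure eight. -/
noncomputable def maxAmplitude (a : ℝ) : ℝ := 3 / 8 * (a - 3 / a)

/-- The amplitude of `M₃` on the level `K` of the Casimir. -/
noncomputable def amplitude (a K : ℝ) : ℝ := √(K - minLevel a)

theorem maxAmplitude_pos {a : ℝ} (ha : √3 < a) : 0 < maxAmplitude a := by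
  have ha0 := pos_of_sqrt_three_lt ha
  have : 3 / a < a := by rw [div_lt_iff₀ ha0]; nlinarith [three_lt_sq ha]
  unfold maxAmplitude; linarith

/-- Because the gap is a perfect square, `K < k(a)` turns into a bound on the amplitude. At equality
the lowest height `-3/(2a) - maxAmplitude a` is `-c(a)/3`, the equilibrium. -/
theorem figureEightLevel_sub_minLevel {a : ℝ} (ha : √3 < a) :
    figureEightLevel a - minLevel a = maxAmplitude a ^ 2 := by
  have ha0 := pos_of_sqrt_three_lt ha
  rw [figureEightLevel_eq, minLevel_eq ha, maxAmplitude, cConst]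
  field_simp
  ring

theorem minLevel_lt_figureEightLevel {a : ℝ} (ha : √3 < a) :
    minLevel a < figureEightLevel a := by
  have := pow_pos (maxAmplitude_pos ha) 2
  linarith [figureEightLevel_sub_minLevel ha]

theorem minLevel_pos {a : ℝ} (ha : √3 < a) : 0 < minLevel a := by
  have ha0 := pos_of_sqrt_three_lt ha
  have hinv : 1 / a ^ 2 < 1 := by
    rw [div_lt_one (by positivity)]; linarith [three_lt_sq ha]
  rw [minLevel_eq ha]; linarith

theorem sqrt_lt_of_lt_figureEightLevel {a K : ℝ} (ha : 0 < a) (hK : K < figureEightLevel a) :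
    √K < cConst a / 3 := by
  have := cConst_pos ha
  rw [Real.sqrt_lt' (by positivity), ← figureEightLevel_eq]
  exact hK


theorem amplitude_pos {a K : ℝ} (hK : minLevel a < K) : 0 < amplitude a K :=
  Real.sqrt_pos.2 (sub_pos.2 hK)

theorem amplitude_sq {a K : ℝ} (hK : minLevel a < K) : amplitude a K ^ 2 = K - minLevel a :=
  Real.sq_sqrt (sub_pos.2 hK).le

theorem amplitude_lt {a K : ℝ} (ha : √3 < a) (hK : K < figureEightLevel a) :
    amplitude a K < maxAmplitude a := by
  rw [amplitude, Real.sqrt_lt' (maxAmplitude_pos ha), ← figureEightLevel_sub_minLevel ha]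
  linarith

/-! ### The phase of the reduced curve -/

/-- The square of the phase speed. -/
noncomputable def speedSq (a ρ φ : ℝ) : ℝ :=
  3 * (a - 1 / a) * (maxAmplitude a + ρ * Real.cos φ) - ρ ^ 2 * Real.sin φ ^ 2

/-- The third coordinate of the reduced curve at phase `φ`. -/
noncomputable def height (a ρ φ : ℝ) : ℝ := -3 / (2 * a) + ρ * Real.cos φ

/-- The point of the reduced curve at phase `φ`; `ε = ± 1` selects the component of the level. -/
noncomputable def curvePoint (a ρ ε φ : ℝ) : Fin 3 → ℝ :=
  ![ε * (√(speedSq a ρ φ) / √(a ^ 2 - 1)), ε * (a * ρ * Real.sin φ / √(a ^ 2 - 1)), height a ρ φ]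

/-- With `r = maxAmplitude a` and `x = cos φ`, the negative term is `ρ²(1 - x)(1 + x) ≤ 2ρ · ρ(1 +
x) ≤ 2r(r + ρx)`, while `8r = 3(a - 3/a) ≤ 3(a - 1/a)` makes the positive term at least `8r(r +
ρx)`. -/
theorem speedSq_pos {a ρ : ℝ} (ha : √3 < a) (h0 : 0 < ρ) (h1 : ρ < maxAmplitude a) (φ : ℝ) :
    0 < speedSq a ρ φ := by
  have ha0 := pos_of_sqrt_three_lt ha
  have hr := maxAmplitude_pos ha
  have hb : 8 * maxAmplitude a ≤ 3 * (a - 1 / a) := by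
    have : 0 < 1 / a := by positivity
    have h3 : 3 / a = 3 * (1 / a) := by ring
    rw [maxAmplitude, h3]; linarith
  have hc1 := Real.neg_one_le_cos φ
  have hc2 := Real.cos_le_one φ
  have hs : Real.sin φ ^ 2 = (1 - Real.cos φ) * (1 + Real.cos φ) := by
    rw [Real.sin_sq]; ring
  set x := Real.cos φ
  set r := maxAmplitude a
  have hpos : 0 < r + ρ * x := by nlinarith
  have h2 : ρ * (ρ * (1 + x)) ≤ r * (r + ρ * x) := by
    have : ρ * (1 + x) ≤ r + ρ * x := by linarith
    exact mul_le_mul h1.le this (by nlinarith) hr.le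
  have h4 : 8 * r * (r + ρ * x) ≤ 3 * (a - 1 / a) * (r + ρ * x) :=
    mul_le_mul_of_nonneg_right hb hpos.le
  have h5 : ρ ^ 2 * ((1 - x) * (1 + x)) ≤ 2 * (ρ * (ρ * (1 + x))) := by
    nlinarith [mul_nonneg (sq_nonneg ρ) (mul_nonneg (by linarith : (0:ℝ) ≤ 1 + x)
      (by linarith : (0:ℝ) ≤ 1 + x))]
  have h6 := mul_pos hr hpos
  rw [speedSq, hs]
  linarith

theorem continuous_speedSq (a ρ : ℝ) : Continuous (speedSq a ρ) := by
  unfold speedSq; fun_prop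

theorem continuous_height (a ρ : ℝ) : Continuous (height a ρ) := by
  unfold height; fun_prop

theorem curvePoint_periodic (a ρ ε : ℝ) :
    Function.Periodic (curvePoint a ρ ε) (2 * Real.pi) := by
  intro φ
  simp [curvePoint, speedSq, height]

theorem speedSq_periodic (a ρ : ℝ) : Function.Periodic (speedSq a ρ) (2 * Real.pi) := by
  intro φ; simp [speedSq]

theorem height_periodic (a ρ : ℝ) : Function.Periodic (height a ρ) (2 * Real.pi) := by
  intro φ; simp [height]

/-! ### Periodic autonomous equations on the line -/

section PhaseEquation

variable {S φ : ℝ → ℝ}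

theorem strictMono_of_hasDerivAt_pos (hpos : ∀ x, 0 < S x)
    (hφ : ∀ t, HasDerivAt φ (S (φ t)) t) : StrictMono φ :=
  strictMono_of_deriv_pos fun t => by rw [(hφ t).deriv]; exact hpos _

/-- Along a solution of `φ' = S(φ)`, time integrals are integrals over the phase. -/
theorem integral_comp_phase (hS : Continuous S) (hpos : ∀ x, 0 < S x)
    (hφ : ∀ t, HasDerivAt φ (S (φ t)) t) {F : ℝ → ℝ} (hF : Continuous F) (t₁ t₂ : ℝ) :
    ∫ t in t₁..t₂, F (φ t) = ∫ x in φ t₁..φ t₂, F x / S x := by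
  have hc : Continuous φ := continuous_iff_continuousAt.2 fun t => (hφ t).continuousAt
  have hq : Continuous fun x => F x / S x := hF.div hS fun x => (hpos x).ne'
  rw [← intervalIntegral.integral_comp_mul_deriv (fun t _ => hφ t)
    (by exact (hS.comp hc).continuousOn) hq]
  refine intervalIntegral.integral_congr fun t _ => ?_
  simp [(hpos (φ t)).ne']

/-- The time `T` is the integral of `1/S` both from `φ 0` to `φ T` and, by periodicity, from `φ 0`
to `φ 0 + 2π`. As `1/S` is positive, the two upper ends agree. -/
theorem phase_return (hS : Continuous S) (hpos : ∀ x, 0 < S x)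
    (hper : Function.Periodic S (2 * Real.pi)) (hφ : ∀ t, HasDerivAt φ (S (φ t)) t) :
    φ (∫ x in (0 : ℝ)..2 * Real.pi, 1 / S x) = φ 0 + 2 * Real.pi := by
  have hq : Continuous fun x => 1 / S x := continuous_const.div hS fun x => (hpos x).ne'
  set T := ∫ x in (0 : ℝ)..2 * Real.pi, 1 / S x
  have h1 : T = ∫ x in φ 0..φ T, 1 / S x := by
    rw [← integral_comp_phase hS hpos hφ (F := fun _ => 1) continuous_const 0 T]
    simp
  have hper' : Function.Periodic (fun x => 1 / S x) (2 * Real.pi) := fun x => by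
    simp only [hper x]
  have h2 : T = ∫ x in φ 0..φ 0 + 2 * Real.pi, 1 / S x := by
    rw [hper'.intervalIntegral_add_eq (φ 0) 0, zero_add]
  have h3 : ∫ x in φ T..φ 0 + 2 * Real.pi, 1 / S x = 0 := by
    have := intervalIntegral.integral_add_adjacent_intervals
      (hq.intervalIntegrable (μ := MeasureTheory.volume) (φ 0) (φ T))
      (hq.intervalIntegrable (φ T) (φ 0 + 2 * Real.pi))
    linarith
  rcases lt_trichotomy (φ T) (φ 0 + 2 * Real.pi) with h | h | h
  · exact absurd h3 (intervalIntegral.intervalIntegral_pos_of_pos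
      (hq.intervalIntegrable _ _) (fun x => one_div_pos.2 (hpos x)) h).ne'
  · exact h
  · rw [intervalIntegral.integral_symm] at h3
    exact absurd (neg_eq_zero.1 h3) (intervalIntegral.intervalIntegral_pos_of_pos
      (hq.intervalIntegrable _ _) (fun x => one_div_pos.2 (hpos x)) h).ne'

/-- Over a full turn, time integrals are integrals over a period of the phase. -/
theorem integral_comp_phase_period (hS : Continuous S) (hpos : ∀ x, 0 < S x)
    (hper : Function.Periodic S (2 * Real.pi)) (hφ : ∀ t, HasDerivAt φ (S (φ t)) t)
    {F : ℝ → ℝ} (hF : Continuous F) (hFper : Function.Periodic F (2 * Real.pi)) :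
    ∫ t in (0 : ℝ)..∫ x in (0 : ℝ)..2 * Real.pi, 1 / S x, F (φ t) =
      ∫ x in (0 : ℝ)..2 * Real.pi, F x / S x := by
  have hper' : Function.Periodic (fun x => F x / S x) (2 * Real.pi) := fun x => by
    simp only [hper x, hFper x]
  rw [integral_comp_phase hS hpos hφ hF, phase_return hS hpos hper hφ,
    hper'.intervalIntegral_add_eq (φ 0) 0, zero_add]

/-- An autonomous equation with continuous, positive, bounded right hand side has a solution on
the whole line. -/
theorem exists_phase (hS : Continuous S) (hpos : ∀ x, 0 < S x) {B : ℝ} (hB : ∀ x, S x ≤ B) :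
    ∃ φ : ℝ → ℝ, ∀ t, HasDerivAt φ (S (φ t)) t := by
  have hq : Continuous fun x => (S x)⁻¹ := hS.inv₀ fun x => (hpos x).ne'
  -- Separation of variables: `G y` is the signed time from phase `0` to phase `y`, and the solution
  -- is its inverse.
  set G : ℝ → ℝ := fun y => ∫ x in (0 : ℝ)..y, (S x)⁻¹
  have hG : ∀ y, HasDerivAt G (S y)⁻¹ y := fun y => hq.integral_hasStrictDerivAt 0 y |>.hasDerivAt
  have hGc : Continuous G := continuous_iff_continuousAt.2 fun t => (hG t).continuousAt
  have hmono : StrictMono G := strictMono_of_deriv_pos fun y => by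
    rw [(hG y).deriv]; exact inv_pos.2 (hpos y)
  have hB0 : 0 < B := (hpos 0).trans_le (hB 0)
  -- The bound `S ≤ B` gives `G` slope at least `1/B`, so `G` is onto `ℝ` and the solution never
  -- escapes in finite time.
  have hmono2 : Monotone fun y => G y - B⁻¹ * y := by
    refine monotone_of_deriv_nonneg
      (fun y => ((hG y).sub ((hasDerivAt_id y).const_mul B⁻¹)).differentiableAt) fun y => ?_
    have : HasDerivAt (fun y => G y - B⁻¹ * y) ((S y)⁻¹ - B⁻¹ * 1) y :=
      (hG y).sub ((hasDerivAt_id y).const_mul B⁻¹)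
    rw [this.deriv, mul_one, sub_nonneg]
    exact inv_anti₀ (hpos y) (hB y)
  have hG0 : G 0 = 0 := intervalIntegral.integral_same
  have htop : Filter.Tendsto G Filter.atTop Filter.atTop := by
    refine Filter.tendsto_atTop_mono' _ ?_
      (Filter.tendsto_id.const_mul_atTop (inv_pos.2 hB0))
    filter_upwards [Filter.eventually_ge_atTop 0] with y hy
    have := hmono2 hy
    simp only [hG0] at this
    simp only [id]; linarith
  have hbot : Filter.Tendsto G Filter.atBot Filter.atBot := by
    refine Filter.tendsto_atBot_mono' _ ?_
      (Filter.tendsto_id.const_mul_atBot (inv_pos.2 hB0))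
    filter_upwards [Filter.eventually_le_atBot 0] with y hy
    have := hmono2 hy
    simp only [hG0] at this
    simp only [id]; linarith
  let e := hmono.orderIsoOfSurjective G (hGc.surjective htop hbot)
  refine ⟨e.symm, fun t => ?_⟩
  have := (hG (e.symm t)).of_local_left_inverse e.symm.continuous.continuousAt
    (inv_ne_zero (hpos _).ne') (Filter.Eventually.of_forall fun y => e.apply_symm_apply y)
  simpa using this

end PhaseEquation

/-! ### Reduced curves -/

/-- A solution of the Lie-Poisson equations with `P = 1` on the paraboloid `H(M, 1) = 0` and on the
level `K` of the Casimir. -/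
structure IsReducedCurve (a K : ℝ) (M : ℝ → Fin 3 → ℝ) : Prop where
  hasDerivAt : ∀ t, HasDerivAt M (M t ⨯₃ angularVelocity a (M t) 1) t
  lightlike : ∀ t, hamiltonian a (M t) 1 = 0
  casimir_eq : ∀ t, casimir (M t) = K

theorem hasDerivAt_reduced_iff {a : ℝ} (ha : a ≠ 0) {M : ℝ → Fin 3 → ℝ} {t : ℝ} :
    HasDerivAt M (M t ⨯₃ angularVelocity a (M t) 1) t ↔
      HasDerivAt (fun s => M s 0) (-(M t 1 * (3 / 2 + M t 2 / a))) t ∧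
      HasDerivAt (fun s => M s 1) (M t 0 * (3 / 2 + a * M t 2)) t ∧
      HasDerivAt (fun s => M s 2) (-((a - 1 / a) * M t 0 * M t 1)) t := by
  rw [hasDerivAt_pi, Fin.forall_fin_succ, Fin.forall_fin_two, angularVelocity_eq ha]
  simp only [cross_apply, Matrix.cons_val, Fin.succ_zero_eq_one, Fin.succ_one_eq_two]
  have e0 : M t 1 * (-3 / 2 * 1) - M t 2 * (M t 1 / a) = -(M t 1 * (3 / 2 + M t 2 / a)) := by ring
  have e1 : M t 2 * (a * M t 0) - M t 0 * (-3 / 2 * 1) = M t 0 * (3 / 2 + a * M t 2) := by ring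
  have e2 : M t 0 * (M t 1 / a) - M t 1 * (a * M t 0) = -((a - 1 / a) * M t 0 * M t 1) := by ring
  rw [e0, e1, e2]

theorem IsLightlikeGeodesic.P_eq {a K : ℝ} {g : ℝ → SU2} {γ : ℝ → ℝ} {M : ℝ → Fin 3 → ℝ}
    {P : ℝ → ℝ} (h : IsLightlikeGeodesic a K g γ M P) (t : ℝ) : P t = 1 := by
  rw [← h.P_eq_one]
  exact is_const_of_deriv_eq_zero (fun t => (h.deriv_P t).differentiableAt)
    (fun t => (h.deriv_P t).deriv) t 0

theorem IsLightlikeGeodesic.isReducedCurve {a K : ℝ} (ha : a ≠ 0) {g : ℝ → SU2} {γ : ℝ → ℝ}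
    {M : ℝ → Fin 3 → ℝ} {P : ℝ → ℝ} (h : IsLightlikeGeodesic a K g γ M P) :
    IsReducedCurve a K M := by
  have hM : ∀ t, HasDerivAt M (M t ⨯₃ angularVelocity a (M t) 1) t := fun t => by
    simpa [h.P_eq t] using h.deriv_M t
  refine ⟨hM, fun t => by simpa [h.P_eq t] using h.lightlike t, fun t => ?_⟩
  have hd : ∀ t, HasDerivAt (fun s => casimir (M s)) 0 t := fun t => by
    obtain ⟨h0, h1, h2⟩ := (hasDerivAt_reduced_iff ha).1 (hM t)
    refine (((h0.pow 2).add (h1.pow 2)).add (h2.pow 2)).congr_deriv ?_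
    push_cast
    field_simp
    ring
  rw [← h.casimir_eq]
  exact is_const_of_deriv_eq_zero (fun t => (hd t).differentiableAt)
    (fun t => (hd t).deriv) t 0

/-- This is where the formula for `speedSq` comes from: the paraboloid determines `M₁²` from `M₂²`
and `M₃`. -/
theorem speedSq_eq_of_lightlike {a K φ : ℝ} (ha : √3 < a)
    {M : Fin 3 → ℝ} (hH : hamiltonian a M 1 = 0) (h2 : M 2 = height a (amplitude a K) φ)
    (h1 : (a ^ 2 - 1) * M 1 ^ 2 = (a * amplitude a K * Real.sin φ) ^ 2) :
    (a ^ 2 - 1) * M 0 ^ 2 = speedSq a (amplitude a K) φ := by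
  have ha0 := pos_of_sqrt_three_lt ha
  rw [hamiltonian_eq ha0.ne'] at hH
  have e0 : M 0 ^ 2 = (3 * M 2 + cConst a - M 1 ^ 2 / a) / a := by
    rw [eq_div_iff ha0.ne']; linarith
  have e1 : (a ^ 2 - 1) * M 0 ^ 2 =
      ((a ^ 2 - 1) * (3 * M 2 + cConst a) - (a ^ 2 - 1) * M 1 ^ 2 / a) / a := by
    rw [e0]; field_simp
  rw [e1, h1, h2, speedSq, height, cConst, maxAmplitude]
  field_simp
  ring

/-- Every point of the level `K` has a phase. -/
theorem exists_angle {a K : ℝ} (ha : √3 < a) (hK : minLevel a < K) {M : Fin 3 → ℝ}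
    (hH : hamiltonian a M 1 = 0) (hC : casimir M = K) {ε : ℝ} (hε : ε ^ 2 = 1) :
    ∃ φ, M 2 = height a (amplitude a K) φ ∧
      ε * M 1 * √(a ^ 2 - 1) = a * amplitude a K * Real.sin φ := by
  have ha0 := pos_of_sqrt_three_lt ha
  have hρ := amplitude_pos hK
  have hsq := amplitude_sq hK
  have hs2 : √(a ^ 2 - 1) ^ 2 = a ^ 2 - 1 :=
    Real.sq_sqrt (by linarith [three_lt_sq ha])
  have hc := casimir_eq_of_lightlike ha0.ne' hH
  rw [hC, ← minLevel_eq ha] at hc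
  set ρ := amplitude a K
  set s := √(a ^ 2 - 1)
  -- The ellipse of the level, rescaled to the unit circle; `φ` is an argument of the resulting
  -- complex number.
  have hone : ((M 2 + 3 / (2 * a)) / ρ) ^ 2 + (ε * M 1 * s / (a * ρ)) ^ 2 = 1 := by
    have : (ε * M 1 * s / (a * ρ)) ^ 2 = ((1 - 1 / a ^ 2) * M 1 ^ 2) / ρ ^ 2 := by
      rw [div_pow, mul_pow, mul_pow, hs2, hε]; field_simp
    rw [this, div_pow, ← add_div, div_eq_one_iff_eq (by positivity)]
    linarith
  obtain ⟨φ, hφ⟩ := (Complex.norm_eq_one_iff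
    (⟨(M 2 + 3 / (2 * a)) / ρ, ε * M 1 * s / (a * ρ)⟩ : ℂ)).1 (by
      rw [Complex.norm_def, Complex.normSq_mk, ← sq, ← sq, hone, Real.sqrt_one])
  have hre := congrArg Complex.re hφ
  have him := congrArg Complex.im hφ
  rw [Complex.exp_ofReal_mul_I_re] at hre
  rw [Complex.exp_ofReal_mul_I_im] at him
  simp only at hre him
  refine ⟨φ, ?_, ?_⟩
  · rw [height, hre]; field_simp; ring
  · rw [him]; field_simp

section

variable {a K : ℝ} {M : ℝ → Fin 3 → ℝ}

theorem IsReducedCurve.coord_zero_ne_zero (h : IsReducedCurve a K M) (ha : √3 < a)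
    (hK : K ∈ Set.Ioo (minLevel a) (figureEightLevel a)) (t : ℝ) : M t 0 ≠ 0 := by
  obtain ⟨φ, h2, h1⟩ := exists_angle ha hK.1 (h.lightlike t) (h.casimir_eq t) (one_pow 2)
  have hs2 : √(a ^ 2 - 1) ^ 2 = a ^ 2 - 1 :=
    Real.sq_sqrt (by linarith [three_lt_sq ha])
  have := speedSq_eq_of_lightlike ha (h.lightlike t) h2 (by rw [← h1, mul_pow, hs2]; ring)
  have hpos := speedSq_pos ha (amplitude_pos hK.1) (amplitude_lt ha hK.2) φ
  intro h0
  rw [h0] at this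
  linarith

theorem exists_sign_of_continuous_ne_zero {f : ℝ → ℝ} (hf : Continuous f) (h0 : ∀ t, f t ≠ 0) :
    ∃ ε : ℝ, ε ^ 2 = 1 ∧ ∀ t, 0 < ε * f t := by
  by_cases h : ∀ t, 0 < f t
  · exact ⟨1, by norm_num, by simpa using h⟩
  · push Not at h
    obtain ⟨s, hs⟩ := h
    refine ⟨-1, by norm_num, fun t => ?_⟩
    by_contra! ht
    obtain ⟨x, hx⟩ := mem_range_of_exists_le_of_exists_ge hf ⟨s, hs⟩ ⟨t, by linarith⟩
    exact h0 x hx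

/-- Every reduced curve is parametrized by its phase. -/
theorem IsReducedCurve.exists_phase (h : IsReducedCurve a K M) (ha : √3 < a)
    (hK : K ∈ Set.Ioo (minLevel a) (figureEightLevel a)) :
    ∃ ε : ℝ, ε ^ 2 = 1 ∧ ∃ φ : ℝ → ℝ,
      (∀ t, HasDerivAt φ (√(speedSq a (amplitude a K) (φ t))) t) ∧
      ∀ t, M t = curvePoint a (amplitude a K) ε (φ t) := by
  have ha0 := pos_of_sqrt_three_lt ha
  have hρ := amplitude_pos hK.1
  have hs := sqrt_sq_sub_one_pos ha
  have hs2 : √(a ^ 2 - 1) ^ 2 = a ^ 2 - 1 :=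
    Real.sq_sqrt (by linarith [three_lt_sq ha])
  have hd := fun t => (hasDerivAt_reduced_iff ha0.ne').1 (h.hasDerivAt t)
  have hc0 : Continuous fun t => M t 0 :=
    continuous_iff_continuousAt.2 fun t => (hd t).1.continuousAt
  obtain ⟨ε, hε, hpos⟩ :=
    exists_sign_of_continuous_ne_zero hc0 (h.coord_zero_ne_zero ha hK)
  obtain ⟨φ₀, hφ2, hφ1⟩ := exists_angle ha hK.1 (h.lightlike 0) (h.casimir_eq 0) hε
  set ρ := amplitude a K with hρdef
  set s := √(a ^ 2 - 1) with hsdef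
  have hcs : Continuous fun t => s * (ε * M t 0) := by fun_prop
  -- The phase is obtained by integrating its expected speed, which avoids choosing a continuous
  -- argument along the curve. That it is the angle of the ellipse is proved afterwards.
  set φ : ℝ → ℝ := fun t => φ₀ + ∫ x in (0 : ℝ)..t, s * (ε * M x 0) with hφdef
  have hφ : ∀ t, HasDerivAt φ (s * (ε * M t 0)) t := fun t =>
    ((hcs.integral_hasStrictDerivAt 0 t).hasDerivAt).const_add φ₀
  have hφ0 : φ 0 = φ₀ := by simp [hφdef]
  have hu : ∀ t, HasDerivAt (fun t => M t 2 + 3 / (2 * a)) (-((a - 1 / a) * M t 0 * M t 1)) t :=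
    fun t => (hd t).2.2.add_const _
  have hv : ∀ t, HasDerivAt (fun t => ε * M t 1 * s / a)
      (ε * (M t 0 * (3 / 2 + a * M t 2)) * s / a) t :=
    fun t => (((hd t).2.1.const_mul ε).mul_const s).div_const a
  -- Put `u = M₃ + 3/(2a)` and `v = ε M₂ s / a`. Then `u' = -φ' v` and `v' = φ' u`, so the
  -- components of `(u, v)` in the frame rotating by `φ` are constant, equal to `(ρ, 0)` by the
  -- choice of `φ₀`.
  have hp : ∀ t, HasDerivAt (fun t => (M t 2 + 3 / (2 * a)) * Real.cos (φ t) +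
      ε * M t 1 * s / a * Real.sin (φ t)) 0 t := fun t => by
    refine (((hu t).mul (hφ t).cos).add ((hv t).mul (hφ t).sin)).congr_deriv ?_
    have e1 : s * (ε * M t 0) * (ε * M t 1 * s / a) = (a - 1 / a) * M t 0 * M t 1 := by
      field_simp
      linear_combination (M t 0 * M t 1 * s ^ 2) * hε + M t 0 * M t 1 * hs2
    have e2 : ε * (M t 0 * (3 / 2 + a * M t 2)) * s / a =
        s * (ε * M t 0) * (M t 2 + 3 / (2 * a)) := by
      field_simp; ring
    rw [e2]
    linear_combination Real.cos (φ t) * e1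
  have hq : ∀ t, HasDerivAt (fun t => ε * M t 1 * s / a * Real.cos (φ t) -
      (M t 2 + 3 / (2 * a)) * Real.sin (φ t)) 0 t := fun t => by
    refine (((hv t).mul (hφ t).cos).sub ((hu t).mul (hφ t).sin)).congr_deriv ?_
    have e1 : s * (ε * M t 0) * (ε * M t 1 * s / a) = (a - 1 / a) * M t 0 * M t 1 := by
      field_simp
      linear_combination (M t 0 * M t 1 * s ^ 2) * hε + M t 0 * M t 1 * hs2
    have e2 : ε * (M t 0 * (3 / 2 + a * M t 2)) * s / a =
        s * (ε * M t 0) * (M t 2 + 3 / (2 * a)) := by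
      field_simp; ring
    rw [e2]
    linear_combination -Real.sin (φ t) * e1
  have hv0 : ε * M 0 1 * s / a = ρ * Real.sin φ₀ := by rw [hφ1]; field_simp
  have hu0 : M 0 2 + 3 / (2 * a) = ρ * Real.cos φ₀ := by rw [hφ2, height]; ring
  have hpt : ∀ t, (M t 2 + 3 / (2 * a)) * Real.cos (φ t) +
      ε * M t 1 * s / a * Real.sin (φ t) = ρ := fun t => by
    have := is_const_of_deriv_eq_zero (fun t => (hp t).differentiableAt)
      (fun t => (hp t).deriv) t 0
    simp only [hφ0, hu0, hv0] at this
    linear_combination this + ρ * Real.sin_sq_add_cos_sq φ₀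
  have hqt : ∀ t, ε * M t 1 * s / a * Real.cos (φ t) -
      (M t 2 + 3 / (2 * a)) * Real.sin (φ t) = 0 := fun t => by
    have := is_const_of_deriv_eq_zero (fun t => (hq t).differentiableAt)
      (fun t => (hq t).deriv) t 0
    simp only [hφ0, hu0, hv0] at this
    linear_combination this
  have h2 : ∀ t, M t 2 = height a ρ (φ t) := fun t => by
    rw [height]
    linear_combination Real.cos (φ t) * hpt t - Real.sin (φ t) * hqt t -
      (M t 2 + 3 / (2 * a)) * Real.sin_sq_add_cos_sq (φ t)
  have h1 : ∀ t, ε * M t 1 * s = a * ρ * Real.sin (φ t) := fun t => by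
    have : ε * M t 1 * s / a = ρ * Real.sin (φ t) := by
      linear_combination Real.sin (φ t) * hpt t + Real.cos (φ t) * hqt t -
        (ε * M t 1 * s / a) * Real.sin_sq_add_cos_sq (φ t)
    field_simp at this
    linear_combination this
  -- The sign `ε` makes `ε M₁` positive, which selects the square root.
  have h0 : ∀ t, √(speedSq a ρ (φ t)) = s * (ε * M t 0) := fun t => by
    rw [← speedSq_eq_of_lightlike ha (h.lightlike t) (h2 t)
      (by rw [← hρdef, ← h1 t, ← hs2]; linear_combination -(M t 1 ^ 2 * s ^ 2) * hε), ← hs2,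
      Real.sqrt_eq_iff_mul_self_eq_of_pos (mul_pos hs (hpos t))]
    linear_combination (s ^ 2 * M t 0 ^ 2) * hε
  refine ⟨ε, hε, φ, fun t => by rw [h0]; exact hφ t, fun t => ?_⟩
  ext i
  fin_cases i
  · simp only [curvePoint, Fin.zero_eta, Matrix.cons_val, h0, ← hsdef]
    field_simp
    linear_combination -(M t 0) * hε
  · simp only [curvePoint, Fin.mk_one, Matrix.cons_val, ← h1, ← hsdef]
    field_simp
    linear_combination -(M t 1) * hε
  · simpa [curvePoint] using h2 t

/-- A solution of the phase equation gives a reduced curve. -/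
theorem isReducedCurve_curvePoint (ha : √3 < a)
    (hK : K ∈ Set.Ioo (minLevel a) (figureEightLevel a)) {φ : ℝ → ℝ}
    (hφ : ∀ t, HasDerivAt φ (√(speedSq a (amplitude a K) (φ t))) t) :
    IsReducedCurve a K fun t => curvePoint a (amplitude a K) 1 (φ t) := by
  have ha0 := pos_of_sqrt_three_lt ha
  have hs := sqrt_sq_sub_one_pos ha
  have hs2 : √(a ^ 2 - 1) ^ 2 = a ^ 2 - 1 :=
    Real.sq_sqrt (by linarith [three_lt_sq ha])
  have hpos := speedSq_pos ha (amplitude_pos hK.1) (amplitude_lt ha hK.2)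
  have hsq := amplitude_sq hK.1
  set ρ := amplitude a K
  set s := √(a ^ 2 - 1) with hsdef
  have hX2 : ∀ x, √(speedSq a ρ x) ^ 2 = speedSq a ρ x := fun x => Real.sq_sqrt (hpos x).le
  have hH : ∀ x, hamiltonian a (curvePoint a ρ 1 x) 1 = 0 := fun x => by
    rw [hamiltonian_eq ha0.ne']
    simp only [curvePoint, Matrix.cons_val, one_mul, div_pow, hX2, ← hsdef]
    have h1 : a ^ 2 - 1 ≠ 0 := by rw [← hs2]; positivity
    rw [hs2, speedSq, height, cConst, maxAmplitude]
    field_simp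
    ring
  refine ⟨fun t => ?_, fun t => hH _, fun t => ?_⟩
  · rw [hasDerivAt_reduced_iff ha0.ne']
    simp only [curvePoint, Matrix.cons_val, one_mul, height, ← hsdef]
    have hX : HasDerivAt (fun t => speedSq a ρ (φ t))
        (3 * (a - 1 / a) * (ρ * (-Real.sin (φ t) * √(speedSq a ρ (φ t)))) -
          ρ ^ 2 * (2 * Real.sin (φ t) * (Real.cos (φ t) * √(speedSq a ρ (φ t))))) t := by
      refine (((((hφ t).cos.const_mul ρ).const_add (maxAmplitude a)).const_mul _).sub
        (((hφ t).sin.pow 2).const_mul (ρ ^ 2))).congr_deriv ?_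
      push_cast
      ring
    have hne : √(speedSq a ρ (φ t)) ≠ 0 := (Real.sqrt_pos.2 (hpos _)).ne'
    refine ⟨((hX.sqrt (hpos _).ne').div_const s).congr_deriv ?_,
      (((hφ t).sin.const_mul (a * ρ)).div_const s).congr_deriv ?_,
      (((hφ t).cos.const_mul ρ).const_add _).congr_deriv ?_⟩
    · field_simp
      ring
    · field_simp
      ring
    · field_simp
      linear_combination (-Real.sin (φ t) * ρ) * hs2
  · rw [casimir_eq_of_lightlike ha0.ne' (hH _), ← minLevel_eq ha]
    simp only [curvePoint, Matrix.cons_val, one_mul, height, div_pow, ← hsdef, hs2, mul_pow]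
    have h1 : a ^ 2 - 1 ≠ 0 := by rw [← hs2]; positivity
    have e : (1 - 1 / a ^ 2) * (a ^ 2 * ρ ^ 2 * Real.sin (φ t) ^ 2 / (a ^ 2 - 1)) =
        ρ ^ 2 * Real.sin (φ t) ^ 2 := by field_simp
    rw [e]
    linear_combination hsq + ρ ^ 2 * Real.sin_sq_add_cos_sq (φ t)

/-- The reduced curve is injective on a period of the phase. -/
theorem add_two_pi_le_of_curvePoint_eq (ha : √3 < a) {ρ : ℝ} (hρ : 0 < ρ) {ε : ℝ} (hε : ε ^ 2 = 1)
    {x y : ℝ} (hxy : x < y) (hy : curvePoint a ρ ε y = curvePoint a ρ ε x) :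
    x + 2 * Real.pi ≤ y := by
  have ha0 := pos_of_sqrt_three_lt ha
  have hs := sqrt_sq_sub_one_pos ha
  have hε0 : ε ≠ 0 := by rintro rfl; norm_num at hε
  have h1 := congrFun hy 1
  have h2 := congrFun hy 2
  simp only [curvePoint, Matrix.cons_val, height] at h1 h2
  have hsin : Real.sin y = Real.sin x := by
    field_simp at h1
    exact h1
  have hcos : Real.cos y = Real.cos x := mul_left_cancel₀ hρ.ne' (add_left_cancel h2)
  have h3 : Real.cos (y - x) = 1 := by
    rw [Real.cos_sub, hsin, hcos, ← sq, ← sq, Real.cos_sq_add_sin_sq]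
  obtain ⟨n, hn⟩ := (Real.cos_eq_one_iff _).1 h3
  have hn0 : (0 : ℝ) < n := by
    by_contra! hle
    nlinarith [Real.pi_pos]
  have hn1 : (1 : ℝ) ≤ n := by exact_mod_cast hn0
  nlinarith [Real.pi_pos]

end

/-! ### The moving frame of a reduced curve -/

theorem toSu2_eq (w : Fin 3 → ℝ) :
    toSu2 w = !![-(Complex.I / 2 * w 2), -(Complex.I * w 0 + w 1) / 2;
      -(Complex.I * w 0 - w 1) / 2, Complex.I / 2 * w 2] := by
  ext i j
  fin_cases i <;> fin_cases j <;>
    simp [toSu2, basisSu2, Fin.sum_univ_three, Matrix.add_apply] <;> ring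

theorem conjTranspose_toSu2 (w : Fin 3 → ℝ) : (toSu2 w)ᴴ = -toSu2 w := by
  rw [toSu2_eq]
  ext i j
  fin_cases i <;> fin_cases j <;> simp <;> ring

/-- The first entry of the moving frame. -/
noncomputable def frameFst (r : ℝ) (M : Fin 3 → ℝ) (ψ : ℝ) : ℂ :=
  (√((r + M 2) / (2 * r)) : ℝ) * Complex.exp ((ψ / 2 : ℝ) * Complex.I)

/-- The second entry of the moving frame. -/
noncomputable def frameSnd (r : ℝ) (M : Fin 3 → ℝ) (ψ : ℝ) : ℂ :=
  (M 0 + M 1 * Complex.I) / (2 * r * √((r + M 2) / (2 * r)) : ℝ) *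
    Complex.exp ((ψ / 2 : ℝ) * Complex.I)

/-- A unitary matrix which rotates `e₃` to `M / r`, preceded by the rotation by the angle `-ψ`
about `e₃`. -/
noncomputable def frame (r : ℝ) (M : Fin 3 → ℝ) (ψ : ℝ) : Matrix (Fin 2) (Fin 2) ℂ :=
  !![frameFst r M ψ, -star (frameSnd r M ψ); frameSnd r M ψ, star (frameFst r M ψ)]

/-- The element `exp(δ e₃)` of `SU(2)`. -/
noncomputable def rotation (δ : ℝ) : Matrix (Fin 2) (Fin 2) ℂ :=
  Matrix.diagonal ![Complex.exp (-((δ / 2 : ℝ) * Complex.I)), Complex.exp ((δ / 2 : ℝ) * Complex.I)]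

theorem exp_smul_toSu2 (δ : ℝ) : NormedSpace.exp (δ • toSu2 ![0, 0, 1]) = rotation δ := by
  have : δ • toSu2 ![0, 0, 1] =
      Matrix.diagonal ![-((δ / 2 : ℝ) * Complex.I), (δ / 2 : ℝ) * Complex.I] := by
    rw [toSu2_eq]
    ext i j
    fin_cases i <;> fin_cases j <;> simp <;> ring
  rw [this, Matrix.exp_diagonal, rotation]
  congr 1
  ext i
  fin_cases i <;> simp [Pi.coe_exp, Complex.exp_eq_exp_ℂ]

theorem star_exp_ofReal_mul_I (x : ℝ) :
    star (Complex.exp (x * Complex.I)) = Complex.exp (-(x * Complex.I)) := by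
  rw [Complex.star_def, ← Complex.exp_conj]
  simp

theorem exp_ofReal_mul_star (x : ℝ) :
    Complex.exp (x * Complex.I) * star (Complex.exp (x * Complex.I)) = 1 := by
  rw [star_exp_ofReal_mul_I, ← Complex.exp_add, add_neg_cancel, Complex.exp_zero]

theorem rotation_neg_mul (δ : ℝ) : rotation (-δ) * rotation δ = 1 := by
  rw [rotation, rotation, Matrix.diagonal_mul_diagonal, ← Matrix.diagonal_one]
  congr 1
  ext i
  fin_cases i <;> simp [← Complex.exp_add] <;> ring_nf <;> simp

/-- Half angles appear in `SU(2)`, whence the period `4π` instead of `2π`. -/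
theorem rotation_eq_iff (δ δ' : ℝ) :
    rotation δ = rotation δ' ↔ ∃ n : ℤ, δ = δ' + n * (4 * Real.pi) := by
  have key : Complex.exp ((δ / 2 : ℝ) * Complex.I) = Complex.exp ((δ' / 2 : ℝ) * Complex.I) ↔
      ∃ n : ℤ, δ = δ' + n * (4 * Real.pi) := by
    rw [Complex.exp_eq_exp_iff_exists_int]
    refine exists_congr fun n => ⟨fun h => ?_, fun h => ?_⟩
    · have h2 := congrArg Complex.im h
      simp at h2
      linarith
    · rw [h]; push_cast; ring
  rw [← key]
  refine ⟨fun h => by simpa [rotation] using congrFun (congrFun h 1) 1, fun h => ?_⟩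
  have h' := congrArg star h
  rw [star_exp_ofReal_mul_I, star_exp_ofReal_mul_I] at h'
  rw [rotation, rotation, h, h']

theorem frame_eq (r : ℝ) (M : Fin 3 → ℝ) (ψ : ℝ) :
    frame r M ψ = frame r M 0 * rotation (-ψ) := by
  have e : ∀ x : ℝ, -(((-x / 2 : ℝ) : ℂ) * Complex.I) = (x / 2 : ℝ) * Complex.I := fun x => by
    push_cast; ring
  have e' : ∀ x : ℝ, (((-x / 2 : ℝ) : ℂ) * Complex.I) = -((x / 2 : ℝ) * Complex.I) := fun x => by
    push_cast; ring
  rw [rotation, e, e']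
  ext i j
  fin_cases i <;> fin_cases j <;>
    simp [frame, frameFst, frameSnd, Matrix.mul_apply, Fin.sum_univ_two, -Complex.ofReal_div,
      ← Complex.exp_conj]

section

variable {r : ℝ} {M : Fin 3 → ℝ}

theorem frame_unitary (hr : 0 < r) (hA : 0 < r + M 2) (hC : casimir M = r ^ 2) (ψ : ℝ) :
    frameFst r M ψ * star (frameFst r M ψ) + frameSnd r M ψ * star (frameSnd r M ψ) = 1 := by
  have hN := Real.sqrt_pos.2 (div_pos hA (mul_pos two_pos hr))
  have hN2 := Real.sq_sqrt (div_pos hA (mul_pos two_pos hr)).le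
  have he := exp_ofReal_mul_star (ψ / 2)
  rw [frameFst, frameSnd]
  set N := √((r + M 2) / (2 * r))
  have hreal : N * N + (M 0 ^ 2 + M 1 ^ 2) / (2 * r * N) ^ 2 = 1 := by
    have h1 : M 0 ^ 2 + M 1 ^ 2 = (r + M 2) * (r - M 2) := by
      rw [casimir] at hC; linarith
    rw [h1, mul_pow, hN2, ← sq, hN2]
    field_simp
    ring
  have hc : ((N : ℂ) * N + (M 0 ^ 2 + M 1 ^ 2) / (2 * r * N) ^ 2) = 1 := by exact_mod_cast hreal
  set e := Complex.exp ((ψ / 2 : ℝ) * Complex.I)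
  have hs : star ((M 0 + M 1 * Complex.I) / (2 * r * N : ℝ) * e) =
      (M 0 - M 1 * Complex.I) / (2 * r * N : ℝ) * star e := by
    simp [sub_eq_add_neg]
  have hs' : star ((N : ℂ) * e) = N * star e := by simp
  rw [hs, hs']
  push_cast
  rw [← hc]
  have hm : ((M 0 : ℂ) + M 1 * Complex.I) * (M 0 - M 1 * Complex.I) = M 0 ^ 2 + M 1 ^ 2 := by
    linear_combination -(M 1 : ℂ) ^ 2 * Complex.I_sq
  rw [← hm]
  generalize 2 * (r : ℂ) * N = d
  linear_combination ((N : ℂ) * N + (M 0 + M 1 * Complex.I) * (M 0 - M 1 * Complex.I) / d ^ 2) * he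

theorem frame_mul_conjTranspose (hr : 0 < r) (hA : 0 < r + M 2) (hC : casimir M = r ^ 2) (ψ : ℝ) :
    frame r M ψ * (frame r M ψ)ᴴ = 1 := by
  have h := frame_unitary hr hA hC ψ
  simp only [Complex.star_def] at h
  ext i j
  fin_cases i <;> fin_cases j <;> simp [frame, Matrix.mul_apply, Fin.sum_univ_two]
  · linear_combination h
  · ring
  · ring
  · linear_combination h

theorem conjTranspose_frame_mem (hr : 0 < r) (hA : 0 < r + M 2) (hC : casimir M = r ^ 2)
    (ψ : ℝ) : (frame r M ψ)ᴴ ∈ Matrix.specialUnitaryGroup (Fin 2) ℂ := by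
  rw [Matrix.mem_specialUnitaryGroup_iff, Matrix.mem_unitaryGroup_iff']
  refine ⟨by simpa [Matrix.star_eq_conjTranspose] using frame_mul_conjTranspose hr hA hC ψ, ?_⟩
  have h := frame_unitary hr hA hC ψ
  simp [frame, Matrix.det_fin_two] at h ⊢
  linear_combination h

/-- The frame rotates `r e₃` to `M`. -/
theorem toSu2_mul_frame (hr : 0 < r) (hA : 0 < r + M 2) (hC : casimir M = r ^ 2) (ψ : ℝ) :
    toSu2 M * frame r M ψ = r • (frame r M ψ * toSu2 ![0, 0, 1]) := by
  have hN := Real.sqrt_pos.2 (div_pos hA (mul_pos two_pos hr))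
  have hN2 := Real.sq_sqrt (div_pos hA (mul_pos two_pos hr)).le
  set N := √((r + M 2) / (2 * r)) with hNdef
  have hN2c : 2 * (r : ℂ) * N ^ 2 = r + M 2 := by
    have : 2 * r * N ^ 2 = r + M 2 := by rw [hN2]; field_simp
    exact_mod_cast this
  have hNc : (N : ℂ) ≠ 0 := by exact_mod_cast hN.ne'
  have hrc : (r : ℂ) ≠ 0 := by exact_mod_cast hr.ne'
  have hCc : (M 0 : ℂ) ^ 2 + M 1 ^ 2 + M 2 ^ 2 = r ^ 2 := by exact_mod_cast hC
  -- The first column of the frame is an eigenvector of `∑ Mⱼ σⱼ` with eigenvalue `r`; conjugating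
  -- its two equations handles the second column, with eigenvalue `-r`.
  have h1 : M 2 * frameFst r M ψ + (M 0 - M 1 * Complex.I) * frameSnd r M ψ =
      r * frameFst r M ψ := by
    rw [frameFst, frameSnd, ← hNdef]
    push_cast
    field_simp
    linear_combination (M 2 - r : ℂ) * hN2c -
      (M 1 : ℂ) ^ 2 * Complex.I_sq + hCc
  have h2 : (M 0 + M 1 * Complex.I) * frameFst r M ψ - M 2 * frameSnd r M ψ =
      r * frameSnd r M ψ := by
    rw [frameFst, frameSnd, ← hNdef]
    push_cast
    field_simp
    linear_combination (M 0 + M 1 * Complex.I) * hN2c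
  have h1' := congrArg star h1
  have h2' := congrArg star h2
  simp at h1' h2'
  rw [toSu2_eq, toSu2_eq, frame]
  ext i j
  fin_cases i <;> fin_cases j <;> simp [Matrix.mul_apply, Fin.sum_univ_two]
  · linear_combination (-Complex.I / 2) * h1 - frameSnd r M ψ * M 1 / 2 * Complex.I_sq
  · linear_combination (-Complex.I / 2) * h2' -
      M 1 * (starRingEnd ℂ) (frameFst r M ψ) / 2 * Complex.I_sq
  · linear_combination (-Complex.I / 2) * h2 + frameFst r M ψ * M 1 / 2 * Complex.I_sq
  · linear_combination (Complex.I / 2) * h1' -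
      M 1 * (starRingEnd ℂ) (frameSnd r M ψ) / 2 * Complex.I_sq

end

/-- The angular velocity of the chain about its momentum, in terms of `r = √K` and `z = M₃`. -/
noncomputable def rotationSpeed (a r z : ℝ) : ℝ := 3 / 2 + (cConst a - 3 * r) / (r + z)

section

variable {a r : ℝ} {M : ℝ → Fin 3 → ℝ} {ψ : ℝ → ℝ} {t : ℝ}

theorem hasDerivAt_exp_half (hψ : HasDerivAt ψ (rotationSpeed a r (M t 2)) t) :
    HasDerivAt (fun s => Complex.exp ((ψ s / 2 : ℝ) * Complex.I))
      (Complex.exp ((ψ t / 2 : ℝ) * Complex.I) *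
        ((rotationSpeed a r (M t 2) / 2 : ℝ) * Complex.I)) t :=
  ((hψ.div_const 2).ofReal_comp.mul_const Complex.I).cexp

/-- Following the direction of `M` fixes the first column up to a phase. The value `rotationSpeed`
of `ψ'` is the one for which the column satisfies the linear equation exactly. -/
theorem hasDerivAt_frame_entries (ha : 0 < a) (hr : 0 < r)
    (hM : HasDerivAt M (M t ⨯₃ angularVelocity a (M t) 1) t)
    (hH : hamiltonian a (M t) 1 = 0) (hC : casimir (M t) = r ^ 2) (hA : 0 < r + M t 2)
    (hψ : HasDerivAt ψ (rotationSpeed a r (M t 2)) t) :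
    HasDerivAt (fun s => frameFst r (M s) (ψ s))
      (-(3 / 4 * Complex.I) * frameFst r (M t) (ψ t) +
        (a * M t 0 * Complex.I + M t 1 / a) / 2 * frameSnd r (M t) (ψ t)) t ∧
    HasDerivAt (fun s => frameSnd r (M s) (ψ s))
      ((a * M t 0 * Complex.I - M t 1 / a) / 2 * frameFst r (M t) (ψ t) +
        3 / 4 * Complex.I * frameSnd r (M t) (ψ t)) t := by
  obtain ⟨h0, h1, h2⟩ := (hasDerivAt_reduced_iff ha.ne').1 hM
  have hN := Real.sqrt_pos.2 (div_pos hA (mul_pos two_pos hr))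
  have hN2 := Real.sq_sqrt (div_pos hA (mul_pos two_pos hr)).le
  have hdN := ((h2.const_add r).div_const (2 * r)).sqrt (div_pos hA (mul_pos two_pos hr)).ne'
  have he := hasDerivAt_exp_half hψ
  have hu := hdN.ofReal_comp.mul he
  have hv := ((h0.ofReal_comp.add (h1.ofReal_comp.mul_const Complex.I)).div
    (hdN.const_mul (2 * r)).ofReal_comp (by
      exact_mod_cast (mul_pos (mul_pos two_pos hr) hN).ne')).mul he
  have hac : (a : ℂ) ≠ 0 := by exact_mod_cast ha.ne'
  have hrc : (r : ℂ) ≠ 0 := by exact_mod_cast hr.ne'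
  -- The light-like condition replaces `c(a)` by `a M₁² + M₂²/a - 3 M₃`, the form in which the speed
  -- arises from differentiating the frame.
  have hp : rotationSpeed a r (M t 2) * (r + M t 2) =
      -(3 / 2) * (r + M t 2) + a * M t 0 ^ 2 + M t 1 ^ 2 / a := by
    rw [hamiltonian_eq ha.ne'] at hH
    rw [rotationSpeed, add_mul, div_mul_cancel₀ _ hA.ne']
    linarith
  set p := rotationSpeed a r (M t 2)
  set N := √((r + M t 2) / (2 * r)) with hNdef
  have hNc : (N : ℂ) ≠ 0 := by exact_mod_cast hN.ne'
  have hN2c : (M t 2 : ℂ) = 2 * (r : ℂ) * N ^ 2 - r := by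
    have : M t 2 = 2 * r * N ^ 2 - r := by rw [hN2]; field_simp; ring
    exact_mod_cast this
  have hpc : (p : ℂ) = (-(3 / 2) * (r + M t 2) + a * M t 0 ^ 2 + M t 1 ^ 2 / a) /
      (2 * r * N ^ 2) := by
    have : p = (-(3 / 2) * (r + M t 2) + a * M t 0 ^ 2 + M t 1 ^ 2 / a) / (2 * r * N ^ 2) := by
      rw [← hp, hN2]; field_simp
    rw [this]; push_cast; ring
  have hCc : (M t 0 : ℂ) ^ 2 + M t 1 ^ 2 + M t 2 ^ 2 = r ^ 2 := by exact_mod_cast hC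
  constructor
  · refine hu.congr_deriv ?_
    simp only [frameFst, frameSnd, ← hNdef]
    push_cast
    rw [hpc]
    generalize Complex.exp (ψ t / 2 * Complex.I) = e
    field_simp
    rw [hN2c]
    ring_nf
    simp only [Complex.I_sq]
    ring
  · refine hv.congr_deriv ?_
    simp only [frameFst, frameSnd, Pi.add_apply, Pi.div_apply, ← hNdef]
    push_cast
    rw [hpc]
    generalize Complex.exp (ψ t / 2 * Complex.I) = e
    field_simp
    rw [hN2c] at hCc ⊢
    linear_combination (norm := skip)
      (8 * e * Complex.I * (a ^ 2 * M t 0 + Complex.I * M t 1)) * hCc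
    ring_nf
    simp only [Complex.I_sq]
    ring

end

theorem hasDerivAt_frame {a r : ℝ} {M : ℝ → Fin 3 → ℝ} {ψ : ℝ → ℝ} {t : ℝ} (ha : 0 < a)
    (hr : 0 < r) (hM : HasDerivAt M (M t ⨯₃ angularVelocity a (M t) 1) t)
    (hH : hamiltonian a (M t) 1 = 0) (hC : casimir (M t) = r ^ 2) (hA : 0 < r + M t 2)
    (hψ : HasDerivAt ψ (rotationSpeed a r (M t 2)) t) (i j : Fin 2) :
    HasDerivAt (fun s => frame r (M s) (ψ s) i j)
      (-(toSu2 (angularVelocity a (M t) 1) * frame r (M t) (ψ t)) i j) t := by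
  obtain ⟨hu, hv⟩ := hasDerivAt_frame_entries ha hr hM hH hC hA hψ
  have hsu := hu.star
  have hsv := hv.star.neg
  rw [toSu2_eq, angularVelocity_eq ha.ne']
  fin_cases i <;> fin_cases j <;> simp [frame, Matrix.mul_apply, Fin.sum_univ_two]
  · refine hu.congr_deriv ?_
    ring
  · refine hsv.congr_deriv ?_
    simp
    ring
  · refine hv.congr_deriv ?_
    ring
  · refine hsu.congr_deriv ?_
    simp
    ring

/-- If `g' = g X` and `U' = - X U`, then `g U` is constant. -/
theorem mul_const_of_hasDerivAt {g U X : ℝ → Matrix (Fin 2) (Fin 2) ℂ}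
    (hg : ∀ t i j, HasDerivAt (fun s => g s i j) ((g t * X t) i j) t)
    (hU : ∀ t i j, HasDerivAt (fun s => U s i j) (-(X t * U t) i j) t) (s t : ℝ) :
    g s * U s = g t * U t := by
  ext i j
  have hd : ∀ t, HasDerivAt (fun s => (g s * U s) i j) 0 t := fun t => by
    simp only [Matrix.mul_apply, Fin.sum_univ_two]
    refine (((hg t i 0).mul (hU t 0 j)).add ((hg t i 1).mul (hU t 1 j))).congr_deriv ?_
    simp only [Matrix.mul_apply, Fin.sum_univ_two]
    ring
  exact is_const_of_deriv_eq_zero (fun t => (hd t).differentiableAt)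
    (fun t => (hd t).deriv) s t

theorem coe_inv_SU2 (g : SU2) :
    ((g⁻¹ : SU2) : Matrix (Fin 2) (Fin 2) ℂ) = (g : Matrix (Fin 2) (Fin 2) ℂ)⁻¹ := by
  refine (Matrix.inv_eq_left_inv ?_).symm
  rw [← Submonoid.coe_mul, inv_mul_cancel, Submonoid.coe_one]

theorem isUnit_SU2 (g : SU2) : IsUnit (g : Matrix (Fin 2) (Fin 2) ℂ) :=
  ⟨⟨g, (g⁻¹ : SU2), by rw [← Submonoid.coe_mul, mul_inv_cancel, Submonoid.coe_one],
    by rw [← Submonoid.coe_mul, inv_mul_cancel, Submonoid.coe_one]⟩, rfl⟩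

/-- The angle of the rotation about the momentum which takes `g(0)` to `g(T)`, when the reduced
curve closes up after time `T` and the moving frame has turned by `Δ`. -/
theorem isHolonomy_iff {g : ℝ → SU2} {M : ℝ → Fin 3 → ℝ} {r T Δ : ℝ} (hr : 0 < r)
    (hA : 0 < r + M 0 2) (hC : casimir (M 0) = r ^ 2)
    (hg : (g T : Matrix (Fin 2) (Fin 2) ℂ) * frame r (M 0) Δ = g 0 * frame r (M 0) 0) (δ : ℝ) :
    IsHolonomy g M T δ ↔ ∃ n : ℤ, δ = Δ + n * (4 * Real.pi) := by
  have hU := frame_mul_conjTranspose hr hA hC 0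
  have hUu : IsUnit (frame r (M 0) 0) :=
    (Matrix.isUnit_iff_isUnit_det _).2 (Matrix.isUnit_det_of_right_inverse hU)
  rw [frame_eq r (M 0) Δ] at hg
  set U := frame r (M 0) 0
  -- The element `h` diagonalizes the momentum: `g(T) = h rotation(Δ) U⁻¹`, and `exp(δ L/|L|) g(0) =
  -- h rotation(δ) h⁻¹ g(0) = h rotation(δ) U⁻¹`. Cancelling leaves an equality of rotations.
  set h : Matrix (Fin 2) (Fin 2) ℂ := g 0 * U
  have hu : IsUnit h := (isUnit_SU2 (g 0)).mul hUu
  have hUdet := (Matrix.isUnit_iff_isUnit_det _).1 hUu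
  have hh : h⁻¹ * g 0 = U⁻¹ := by
    rw [Matrix.mul_inv_rev, mul_assoc,
      Matrix.nonsing_inv_mul _ ((Matrix.isUnit_iff_isUnit_det _).1 (isUnit_SU2 (g 0))), mul_one]
  have hrot : rotation (-Δ) * rotation Δ = 1 := rotation_neg_mul Δ
  have hgT : (g T : Matrix (Fin 2) (Fin 2) ℂ) = h * rotation Δ * U⁻¹ := by
    rw [← hg]
    simp only [mul_assoc]
    rw [← mul_assoc (rotation (-Δ)), hrot, one_mul, Matrix.mul_nonsing_inv _ hUdet, mul_one]
  have hL : momentumMap (g 0) (M 0) = r • (h * toSu2 ![0, 0, 1] * h⁻¹) := by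
    have h1 : toSu2 (M 0) = r • (U * toSu2 ![0, 0, 1] * U⁻¹) := by
      rw [← Matrix.smul_mul, ← toSu2_mul_frame hr hA hC 0, mul_assoc,
        Matrix.mul_nonsing_inv _ hUdet, mul_one]
    rw [momentumMap, coe_inv_SU2, h1, Matrix.mul_inv_rev, Matrix.mul_smul, Matrix.smul_mul]
    simp only [h, mul_assoc]
  have hexp : NormedSpace.exp ((δ / √(casimir (M 0))) • momentumMap (g 0) (M 0)) =
      h * rotation δ * h⁻¹ := by
    rw [hL, hC, Real.sqrt_sq hr.le, smul_smul, div_mul_cancel₀ _ hr.ne', ← exp_smul_toSu2,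
      ← Matrix.exp_conj _ _ hu, Matrix.mul_smul, Matrix.smul_mul]
  rw [IsHolonomy, hexp, hgT, mul_assoc (h * rotation δ), hh, ← rotation_eq_iff]
  constructor
  · intro e
    have hUi : IsUnit U⁻¹ := Matrix.isUnit_nonsing_inv_iff.2 hUu
    exact (hu.mul_left_cancel (hUi.mul_right_cancel e)).symm
  · intro e
    rw [e]

section

variable {a K : ℝ} {M : ℝ → Fin 3 → ℝ}

/-- Since `M₁` never vanishes, `|M₃| < √K`. The curve thus avoids the south pole, where both the
frame and the solid angle form are singular. -/
theorem IsReducedCurve.sqrt_add_pos (h : IsReducedCurve a K M) (ha : √3 < a)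
    (hK : K ∈ Set.Ioo (minLevel a) (figureEightLevel a)) (t : ℝ) : 0 < √K + M t 2 := by
  have h0 := h.coord_zero_ne_zero ha hK t
  have hC := h.casimir_eq t
  have : |M t 2| < √K := by
    rw [← Real.sqrt_sq_eq_abs]
    refine Real.sqrt_lt_sqrt (sq_nonneg _) ?_
    rw [casimir] at hC
    have : 0 < M t 0 ^ 2 := by positivity
    nlinarith [sq_nonneg (M t 1)]
  linarith [(abs_lt.1 this).1]

theorem IsReducedCurve.hasDerivAt_coords (h : IsReducedCurve a K M) (ha : √3 < a) (t : ℝ) :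
    HasDerivAt (fun s => M s 0) (-(M t 1 * (3 / 2 + M t 2 / a))) t ∧
      HasDerivAt (fun s => M s 1) (M t 0 * (3 / 2 + a * M t 2)) t ∧
      HasDerivAt (fun s => M s 2) (-((a - 1 / a) * M t 0 * M t 1)) t :=
  (hasDerivAt_reduced_iff (pos_of_sqrt_three_lt ha).ne').1 (h.hasDerivAt t)

theorem IsReducedCurve.continuous (h : IsReducedCurve a K M) : Continuous M :=
  continuous_iff_continuousAt.2 fun t => (h.hasDerivAt t).continuousAt

theorem IsReducedCurve.continuous_rotationSpeed (h : IsReducedCurve a K M) (ha : √3 < a)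
    (hK : K ∈ Set.Ioo (minLevel a) (figureEightLevel a)) :
    Continuous fun t => rotationSpeed a (√K) (M t 2) := by
  have := h.continuous
  unfold rotationSpeed
  exact continuous_const.add (continuous_const.div (by fun_prop)
    fun t => (h.sqrt_add_pos ha hK t).ne')

theorem IsReducedCurve.hasDerivAt_frame (h : IsReducedCurve a K M) (ha : √3 < a)
    (hK : K ∈ Set.Ioo (minLevel a) (figureEightLevel a)) (t : ℝ) (i j : Fin 2) :
    HasDerivAt
      (fun s => frame (√K) (M s) (∫ x in (0 : ℝ)..s, rotationSpeed a (√K) (M x 2)) i j)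
      (-(toSu2 (angularVelocity a (M t) 1) *
        frame (√K) (M t) (∫ x in (0 : ℝ)..t, rotationSpeed a (√K) (M x 2))) i j) t := by
  have hK0 := (minLevel_pos ha).trans hK.1
  exact ChainsSU2.hasDerivAt_frame (pos_of_sqrt_three_lt ha) (Real.sqrt_pos.2 hK0) (h.hasDerivAt t)
    (h.lightlike t) (by rw [h.casimir_eq t, Real.sq_sqrt hK0.le]) (h.sqrt_add_pos ha hK t)
    ((h.continuous_rotationSpeed ha hK).integral_hasStrictDerivAt 0 t).hasDerivAt i j

/-- Every reduced curve lifts to a light-like geodesic. -/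
theorem IsReducedCurve.exists_geodesic (h : IsReducedCurve a K M) (ha : √3 < a)
    (hK : K ∈ Set.Ioo (minLevel a) (figureEightLevel a)) :
    ∃ g γ M P, IsLightlikeGeodesic a K g γ M P := by
  have ha0 := pos_of_sqrt_three_lt ha
  have hK0 := (minLevel_pos ha).trans hK.1
  have hc := h.continuous
  set ψ : ℝ → ℝ := fun s => ∫ x in (0 : ℝ)..s, rotationSpeed a (√K) (M x 2)
  have hmem : ∀ t, (frame (√K) (M t) (ψ t))ᴴ ∈ Matrix.specialUnitaryGroup (Fin 2) ℂ := fun t =>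
    conjTranspose_frame_mem (Real.sqrt_pos.2 hK0) (h.sqrt_add_pos ha hK t)
      (by rw [h.casimir_eq t, Real.sq_sqrt hK0.le]) _
  -- The chain is `g = Uᴴ`: taking adjoints in `U' = -X U`, with `X` skew-Hermitian, gives `g' = g
  -- X`.
  refine ⟨fun t => ⟨_, hmem t⟩, fun t => ∫ s in (0 : ℝ)..t, velocity a (M s) 1 3, M, fun _ => 1,
    fun t i j => ?_, fun t => ?_, h.hasDerivAt, fun t => hasDerivAt_const t 1, h.lightlike, rfl,
    h.casimir_eq 0⟩
  · refine ((h.hasDerivAt_frame ha hK t j i).star).congr_deriv ?_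
    have e : (frame (√K) (M t) (ψ t))ᴴ * toSu2 (angularVelocity a (M t) 1) =
        (-(toSu2 (angularVelocity a (M t) 1) * frame (√K) (M t) (ψ t)))ᴴ := by
      rw [Matrix.conjTranspose_neg, Matrix.conjTranspose_mul, conjTranspose_toSu2, mul_neg, neg_neg]
    simp only [e, Matrix.conjTranspose_apply, Matrix.neg_apply]
    rfl
  · have : Continuous fun s => velocity a (M s) 1 3 := by
      simp only [velocity_eq ha0.ne', Matrix.cons_val]
      fun_prop
    exact (this.integral_hasStrictDerivAt 0 t).hasDerivAt

theorem IsLightlikeGeodesic.isHolonomy_iff {g : ℝ → SU2} {γ : ℝ → ℝ} {P : ℝ → ℝ}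
    (h : IsLightlikeGeodesic a K g γ M P) (ha : √3 < a)
    (hK : K ∈ Set.Ioo (minLevel a) (figureEightLevel a)) {T : ℝ} (hT : M T = M 0) (δ : ℝ) :
    IsHolonomy g M T δ ↔
      ∃ n : ℤ, δ = (∫ t in (0 : ℝ)..T, rotationSpeed a (√K) (M t 2)) + n * (4 * Real.pi) := by
  have hM := h.isReducedCurve (pos_of_sqrt_three_lt ha).ne'
  have hK0 := (minLevel_pos ha).trans hK.1
  refine ChainsSU2.isHolonomy_iff (Real.sqrt_pos.2 hK0) (hM.sqrt_add_pos ha hK 0)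
    (by rw [hM.casimir_eq 0, Real.sq_sqrt hK0.le]) ?_ δ
  have := mul_const_of_hasDerivAt (g := fun t => (g t : Matrix (Fin 2) (Fin 2) ℂ))
    (fun t i j => by simpa only [h.P_eq t] using h.deriv_g t i j)
    (hM.hasDerivAt_frame ha hK) T 0
  simpa only [hT, intervalIntegral.integral_same] using this

/-- The rotation speed is the dynamic speed minus the speed of the solid angle. -/
theorem IsReducedCurve.rotationSpeed_eq (h : IsReducedCurve a K M) (ha : √3 < a)
    (hK : K ∈ Set.Ioo (minLevel a) (figureEightLevel a)) (t : ℝ) :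
    (1 / √K) * ((1 / 2) * (a * M t 0 ^ 2 + M t 1 ^ 2 / a + cConst a)) -
      (M t 0 * deriv (fun s => M s 1) t - M t 1 * deriv (fun s => M s 0) t) /
        (√K * (√K + M t 2)) = rotationSpeed a (√K) (M t 2) := by
  have ha0 := pos_of_sqrt_three_lt ha
  have hK0 := (minLevel_pos ha).trans hK.1
  have hr := Real.sqrt_pos.2 hK0
  have hA := h.sqrt_add_pos ha hK t
  obtain ⟨h0, h1, -⟩ := h.hasDerivAt_coords ha t
  have hH := h.lightlike t
  have hC := h.casimir_eq t
  rw [← Real.sq_sqrt hK0.le] at hC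
  rw [h0.deriv, h1.deriv, rotationSpeed]
  rw [hamiltonian_eq ha0.ne'] at hH
  -- The paraboloid and the Casimir together express both integrands through `M₃` alone.
  have e1 : M t 1 ^ 2 / a = 3 * M t 2 + cConst a - a * M t 0 ^ 2 := by linarith
  have e2 : M t 0 * (M t 0 * (3 / 2 + a * M t 2)) - M t 1 * -(M t 1 * (3 / 2 + M t 2 / a)) =
      3 / 2 * (√K ^ 2 - M t 2 ^ 2) + M t 2 * (3 * M t 2 + cConst a) := by
    rw [← hC, casimir]
    linear_combination M t 2 * e1
  rw [e1, e2]
  field_simp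
  ring

theorem IsReducedCurve.integral_rotationSpeed (h : IsReducedCurve a K M) (ha : √3 < a)
    (hK : K ∈ Set.Ioo (minLevel a) (figureEightLevel a)) (T : ℝ) :
    ∫ t in (0 : ℝ)..T, rotationSpeed a (√K) (M t 2) =
      dynamicTerm a K M T - solidAngle (√K) M T := by
  have hc := h.continuous
  have hK0 := (minLevel_pos ha).trans hK.1
  have hd0 : deriv (fun s => M s 0) = fun t => -(M t 1 * (3 / 2 + M t 2 / a)) :=
    funext fun t => (h.hasDerivAt_coords ha t).1.deriv
  have hd1 : deriv (fun s => M s 1) = fun t => M t 0 * (3 / 2 + a * M t 2) :=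
    funext fun t => (h.hasDerivAt_coords ha t).2.1.deriv
  rw [dynamicTerm, solidAngle, ← intervalIntegral.integral_const_mul,
    ← intervalIntegral.integral_sub]
  · exact intervalIntegral.integral_congr fun t _ => (h.rotationSpeed_eq ha hK t).symm
  · exact Continuous.intervalIntegrable (by fun_prop) _ _
  · refine Continuous.intervalIntegrable (Continuous.div ?_ (by fun_prop) fun t =>
      (mul_pos (Real.sqrt_pos.2 hK0) (h.sqrt_add_pos ha hK t)).ne') _ _
    rw [hd0, hd1]
    fun_prop

end

/-! ### The holonomy as a function of the Casimir -/

/-- The phase speed on the level `K`. -/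
noncomputable def phaseSpeed (a K φ : ℝ) : ℝ := √(speedSq a (amplitude a K) φ)

/-- The first return time of the reduced curves on the level `K`. -/
noncomputable def returnTime (a K : ℝ) : ℝ := ∫ φ in (0 : ℝ)..2 * Real.pi, 1 / phaseSpeed a K φ

/-- The dynamic term of the chains on the level `K`. -/
noncomputable def levelDynamicTerm (a K : ℝ) : ℝ :=
  (1 / √K) * ∫ φ in (0 : ℝ)..2 * Real.pi,
    (3 / 2 * height a (amplitude a K) φ + cConst a) / phaseSpeed a K φ

/-- The holonomy of the chains on the level `K`. -/
noncomputable def levelHolonomy (a K : ℝ) : ℝ :=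
  ∫ φ in (0 : ℝ)..2 * Real.pi,
    rotationSpeed a (√K) (height a (amplitude a K) φ) / phaseSpeed a K φ

section

variable {a K : ℝ}

theorem phaseSpeed_pos (ha : √3 < a) (hK : K ∈ Set.Ioo (minLevel a) (figureEightLevel a)) (φ : ℝ) :
    0 < phaseSpeed a K φ :=
  Real.sqrt_pos.2 (speedSq_pos ha (amplitude_pos hK.1) (amplitude_lt ha hK.2) φ)

theorem continuous_phaseSpeed (a K : ℝ) : Continuous (phaseSpeed a K) :=
  (continuous_speedSq a _).sqrt

theorem phaseSpeed_periodic (a K : ℝ) : Function.Periodic (phaseSpeed a K) (2 * Real.pi) :=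
  fun φ => by rw [phaseSpeed, speedSq_periodic, phaseSpeed]

theorem neg_amplitude_le (a K φ : ℝ) :
    -3 / (2 * a) - amplitude a K ≤ height a (amplitude a K) φ := by
  have h := mul_le_mul_of_nonneg_left (Real.neg_one_le_cos φ) (Real.sqrt_nonneg (K - minLevel a))
  rw [height]
  rw [← amplitude] at h
  linarith

theorem neg_cConst_lt_height (ha : √3 < a) (hK : K < figureEightLevel a) (φ : ℝ) :
    -cConst a / 3 < height a (amplitude a K) φ := by
  have ha0 := pos_of_sqrt_three_lt ha
  have h1 := neg_amplitude_le a K φ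
  have h2 := amplitude_lt ha hK
  have h3 : -3 / (2 * a) - maxAmplitude a = -cConst a / 3 := by
    rw [maxAmplitude, cConst]; field_simp; ring
  linarith

/-- The lowest point stays above the south pole: `(3/(2a) + ρ)² < K = m(a) + ρ²` amounts to `(3/a) ρ
< m(a) - 9/(4a²)`, whose right side is exactly `(3/a) maxAmplitude a`. -/
theorem sqrt_add_height_pos (ha : √3 < a)
    (hK : K ∈ Set.Ioo (minLevel a) (figureEightLevel a)) (φ : ℝ) :
    0 < √K + height a (amplitude a K) φ := by
  have ha0 := pos_of_sqrt_three_lt ha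
  have h1 := neg_amplitude_le a K φ
  have h2 := amplitude_lt ha hK.2
  have h3 := amplitude_sq hK.1
  have h4 := amplitude_pos hK.1
  have h5 : 3 / (2 * a) + amplitude a K < √K := by
    rw [Real.lt_sqrt (by positivity)]
    have h6 : 3 / a * amplitude a K < 3 / a * maxAmplitude a :=
      mul_lt_mul_of_pos_left h2 (by positivity)
    have h7 : 3 / a * maxAmplitude a = minLevel a - 9 / (4 * a ^ 2) := by
      rw [minLevel_eq ha, maxAmplitude]; field_simp; ring
    have h8 : (3 / (2 * a) + amplitude a K) ^ 2 =
        9 / (4 * a ^ 2) + 3 / a * amplitude a K + amplitude a K ^ 2 := by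
      field_simp; ring
    rw [h8]; linarith
  have h9 : -3 / (2 * a) = -(3 / (2 * a)) := by ring
  linarith

theorem three_halves_le_rotationSpeed (ha : √3 < a)
    (hK : K ∈ Set.Ioo (minLevel a) (figureEightLevel a)) (φ : ℝ) :
    3 / 2 ≤ rotationSpeed a (√K) (height a (amplitude a K) φ) := by
  have h1 := sqrt_lt_of_lt_figureEightLevel (pos_of_sqrt_three_lt ha) hK.2
  have := div_nonneg (by linarith : 0 ≤ cConst a - 3 * √K) (sqrt_add_height_pos ha hK φ).le
  rw [rotationSpeed]
  linarith

theorem continuous_rotationSpeed_height (ha : √3 < a)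
    (hK : K ∈ Set.Ioo (minLevel a) (figureEightLevel a)) :
    Continuous fun φ => rotationSpeed a (√K) (height a (amplitude a K) φ) := by
  unfold rotationSpeed
  exact continuous_const.add (continuous_const.div
    (continuous_const.add (continuous_height a _)) fun φ => (sqrt_add_height_pos ha hK φ).ne')

theorem returnTime_pos (ha : √3 < a) (hK : K ∈ Set.Ioo (minLevel a) (figureEightLevel a)) :
    0 < returnTime a K :=
  intervalIntegral.intervalIntegral_pos_of_pos
    ((continuous_const.div (continuous_phaseSpeed a K)
      fun φ => (phaseSpeed_pos ha hK φ).ne').intervalIntegrable _ _)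
    (fun φ => one_div_pos.2 (phaseSpeed_pos ha hK φ)) Real.two_pi_pos

/-- An average over the phase is at least the minimum times the return time. -/
theorem mul_returnTime_le (ha : √3 < a) (hK : K ∈ Set.Ioo (minLevel a) (figureEightLevel a))
    {F : ℝ → ℝ} (hF : Continuous F) {b : ℝ} (hb : ∀ φ, b ≤ F φ) :
    b * returnTime a K ≤ ∫ φ in (0 : ℝ)..2 * Real.pi, F φ / phaseSpeed a K φ := by
  have hne := fun φ => (phaseSpeed_pos ha hK φ).ne'
  have hS := continuous_phaseSpeed a K
  rw [returnTime, ← intervalIntegral.integral_const_mul]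
  refine intervalIntegral.integral_mono_on Real.two_pi_pos.le
    ((continuous_const.mul (continuous_const.div hS hne)).intervalIntegrable _ _)
    ((hF.div hS hne).intervalIntegrable _ _) fun φ _ => ?_
  rw [mul_one_div]
  exact div_le_div_of_nonneg_right (hb φ) (phaseSpeed_pos ha hK φ).le

theorem returnTime_le_levelHolonomy (ha : √3 < a)
    (hK : K ∈ Set.Ioo (minLevel a) (figureEightLevel a)) :
    3 / 2 * returnTime a K ≤ levelHolonomy a K :=
  mul_returnTime_le ha hK (continuous_rotationSpeed_height ha hK)
    (three_halves_le_rotationSpeed ha hK)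

/-- On the paraboloid `f = (3/2) M₃ + c(a)`. This exceeds `c(a)/2` because `M₃ > -c(a)/3`, and `√K <
c(a)/3` then gives `f/√K ≥ 3/2`. -/
theorem returnTime_le_levelDynamicTerm (ha : √3 < a)
    (hK : K ∈ Set.Ioo (minLevel a) (figureEightLevel a)) :
    3 / 2 * returnTime a K ≤ levelDynamicTerm a K := by
  have hr := Real.sqrt_pos.2 ((minLevel_pos ha).trans hK.1)
  have h1 := sqrt_lt_of_lt_figureEightLevel (pos_of_sqrt_three_lt ha) hK.2
  have h2 : cConst a / 2 * returnTime a K ≤ _ :=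
    mul_returnTime_le ha hK (F := fun φ => 3 / 2 * height a (amplitude a K) φ + cConst a)
      (by have := continuous_height a (amplitude a K); fun_prop)
      fun φ => by linarith [neg_cConst_lt_height ha hK.2 φ]
  have h3 : 3 / 2 ≤ 1 / √K * (cConst a / 2) := by
    rw [one_div_mul_eq_div, le_div_iff₀ hr]; linarith
  have h4 := mul_le_mul_of_nonneg_right h3 (returnTime_pos ha hK).le
  have h5 := mul_le_mul_of_nonneg_left h2 (one_div_pos.2 hr).le
  rw [levelDynamicTerm]
  linarith

/-- In the phase variable the interval of integration does not depend on `K`, so joint continuity of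
the integrand suffices. -/
theorem continuousOn_levelHolonomy (ha : √3 < a) :
    ContinuousOn (levelHolonomy a) (Set.Ioo (minLevel a) (figureEightLevel a)) := by
  rw [continuousOn_iff_continuous_domRestrict]
  refine intervalIntegral.continuous_parametric_intervalIntegral_of_continuous'
    (f := fun (K : Set.Ioo (minLevel a) (figureEightLevel a)) φ =>
      rotationSpeed a (√K) (height a (amplitude a K) φ) / phaseSpeed a K φ) ?_ 0 (2 * Real.pi)
  refine Continuous.div (Continuous.add continuous_const (Continuous.div ?_ ?_ fun p => ?_)) ?_
    fun p => (phaseSpeed_pos ha p.1.2 p.2).ne'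
  · fun_prop
  · unfold height amplitude
    fun_prop
  · exact (sqrt_add_height_pos ha p.1.2 p.2).ne'
  · unfold phaseSpeed speedSq amplitude
    fun_prop

/-! ### Divergence at the figure eight -/

/-- At `φ = π + u` drop the term `-ρ² sin²` and use `cos u ≥ 1 - u²/2`. An affine bound for the
speed is enough to make the integral of its inverse diverge logarithmically. -/
theorem phaseSpeed_pi_add_le (ha : √3 < a)
    (hK : K ∈ Set.Ioo (minLevel a) (figureEightLevel a)) {u : ℝ} (hu : 0 ≤ u) :
    phaseSpeed a K (Real.pi + u) ≤ √(3 * (a - 1 / a)) *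
      (√(maxAmplitude a - amplitude a K) + √(maxAmplitude a) * u) := by
  have ha0 := pos_of_sqrt_three_lt ha
  have hr := maxAmplitude_pos ha
  have hlt := amplitude_lt ha hK.2
  have hρ := amplitude_pos hK.1
  have hb : 0 < 3 * (a - 1 / a) := by
    have : 1 / a < a := by rw [div_lt_iff₀ ha0]; nlinarith [three_lt_sq ha]
    linarith
  have h1 := Real.sq_sqrt (sub_pos.2 hlt).le
  have h2 := Real.sq_sqrt hr.le
  have hcos := Real.one_sub_sq_div_two_le_cos (x := u)
  rw [phaseSpeed, Real.sqrt_le_left (by positivity), mul_pow, Real.sq_sqrt hb.le, speedSq,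
    add_comm Real.pi, Real.cos_add_pi]
  have h3 : maxAmplitude a + amplitude a K * -Real.cos u ≤
      (√(maxAmplitude a - amplitude a K) + √(maxAmplitude a) * u) ^ 2 := by
    have h4 : amplitude a K * (1 - u ^ 2 / 2) ≤ amplitude a K * Real.cos u :=
      mul_le_mul_of_nonneg_left hcos hρ.le
    have h5 : amplitude a K * u ^ 2 ≤ maxAmplitude a * u ^ 2 :=
      mul_le_mul_of_nonneg_right hlt.le (sq_nonneg u)
    have h6 : 0 ≤ √(maxAmplitude a - amplitude a K) * (√(maxAmplitude a) * u) := by positivity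
    have h7 : 0 ≤ maxAmplitude a * u ^ 2 := by positivity
    rw [add_sq, mul_pow, h1, h2]
    nlinarith
  have h8 := mul_le_mul_of_nonneg_left h3 hb.le
  have h9 : 0 ≤ amplitude a K ^ 2 * Real.sin (u + Real.pi) ^ 2 := by positivity
  linarith

theorem integral_one_div_affine {C D η : ℝ} (hC : 0 < C) (hD : 0 < D) (hη : 0 < η) :
    ∫ u in (0 : ℝ)..1, 1 / (C * (η + D * u)) = Real.log (1 + D / η) / (C * D) := by
  have hpos : ∀ u ∈ Set.uIcc (0 : ℝ) 1, 0 < η + D * u := fun u hu => by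
    rw [Set.uIcc_of_le zero_le_one] at hu
    have := mul_nonneg hD.le hu.1
    linarith
  have hd : ∀ u ∈ Set.uIcc (0 : ℝ) 1,
      HasDerivAt (fun u => Real.log (η + D * u) / (C * D)) (1 / (C * (η + D * u))) u :=
    fun u hu => by
      have h := hpos u hu
      refine (((((hasDerivAt_id u).const_mul D).const_add η).log h.ne').div_const _).congr_deriv ?_
      simp only [id, mul_one]
      field_simp
  rw [intervalIntegral.integral_eq_sub_of_hasDerivAt hd, ← sub_div, mul_zero, add_zero, mul_one,
    ← Real.log_div (by positivity) hη.ne', add_div, div_self hη.ne']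
  refine ContinuousOn.intervalIntegrable (ContinuousOn.div continuousOn_const (by fun_prop) ?_)
  intro u hu
  exact (mul_pos hC (hpos u hu)).ne'

theorem log_le_returnTime (ha : √3 < a)
    (hK : K ∈ Set.Ioo (minLevel a) (figureEightLevel a)) :
    Real.log (1 + √(maxAmplitude a) / √(maxAmplitude a - amplitude a K)) /
      (√(3 * (a - 1 / a)) * √(maxAmplitude a)) ≤ returnTime a K := by
  have ha0 := pos_of_sqrt_three_lt ha
  have hb : 0 < √(3 * (a - 1 / a)) := by
    have : 1 / a < a := by rw [div_lt_iff₀ ha0]; nlinarith [three_lt_sq ha]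
    exact Real.sqrt_pos.2 (by linarith)
  have hD := Real.sqrt_pos.2 (maxAmplitude_pos ha)
  have hη := Real.sqrt_pos.2 (sub_pos.2 (amplitude_lt ha hK.2))
  have hq : Continuous fun φ => 1 / phaseSpeed a K φ :=
    continuous_const.div (continuous_phaseSpeed a K) fun φ => (phaseSpeed_pos ha hK φ).ne'
  rw [← integral_one_div_affine hb hD hη]
  -- Only a one-sided neighbourhood of the slow phase `π` is kept; `π + 1 ≤ 2π`.
  have h1 : ∫ φ in Real.pi..Real.pi + 1, 1 / phaseSpeed a K φ ≤ returnTime a K :=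
    intervalIntegral.integral_mono_interval Real.pi_pos.le (by linarith)
      (by linarith [Real.pi_gt_three])
      (Filter.Eventually.of_forall fun φ => (one_div_pos.2 (phaseSpeed_pos ha hK φ)).le)
      (hq.intervalIntegrable _ _)
  have h2 : ∫ φ in Real.pi..Real.pi + 1, 1 / phaseSpeed a K φ =
      ∫ u in (0 : ℝ)..1, 1 / phaseSpeed a K (Real.pi + u) := by
    rw [intervalIntegral.integral_comp_add_left (fun φ => 1 / phaseSpeed a K φ), add_zero]
  rw [h2] at h1
  refine le_trans (intervalIntegral.integral_mono_on zero_le_one ?_ ?_ fun u hu => ?_) h1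
  · refine ContinuousOn.intervalIntegrable (ContinuousOn.div continuousOn_const (by fun_prop) ?_)
    intro u hu
    rw [Set.uIcc_of_le zero_le_one] at hu
    have := mul_nonneg hD.le hu.1
    positivity
  · exact (hq.comp (continuous_const.add continuous_id)).intervalIntegrable _ _
  · exact one_div_le_one_div_of_le (phaseSpeed_pos ha hK _) (phaseSpeed_pi_add_le ha hK hu.1)

theorem eventually_mem_levels (ha : √3 < a) :
    ∀ᶠ K in 𝓝[<] (figureEightLevel a), K ∈ Set.Ioo (minLevel a) (figureEightLevel a) :=
  Ioo_mem_nhdsLT (minLevel_lt_figureEightLevel ha)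

theorem tendsto_returnTime (ha : √3 < a) :
    Filter.Tendsto (returnTime a) (𝓝[<] (figureEightLevel a)) Filter.atTop := by
  have ha0 := pos_of_sqrt_three_lt ha
  have hb : 0 < √(3 * (a - 1 / a)) := by
    have : 1 / a < a := by rw [div_lt_iff₀ ha0]; nlinarith [three_lt_sq ha]
    exact Real.sqrt_pos.2 (by linarith)
  have hD := Real.sqrt_pos.2 (maxAmplitude_pos ha)
  have hη : Filter.Tendsto (fun K => √(maxAmplitude a - amplitude a K))
      (𝓝[<] (figureEightLevel a)) (𝓝[>] 0) := by
    refine tendsto_nhdsWithin_iff.2 ⟨?_, ?_⟩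
    · have hc : Continuous fun K => √(maxAmplitude a - amplitude a K) := by
        unfold amplitude; fun_prop
      have h0 : √(maxAmplitude a - amplitude a (figureEightLevel a)) = 0 := by
        rw [amplitude, figureEightLevel_sub_minLevel ha, Real.sqrt_sq (maxAmplitude_pos ha).le,
          sub_self, Real.sqrt_zero]
      have := hc.tendsto (figureEightLevel a)
      rw [h0] at this
      exact this.mono_left nhdsWithin_le_nhds
    · filter_upwards [self_mem_nhdsWithin] with K hK
      exact Real.sqrt_pos.2 (sub_pos.2 (amplitude_lt ha hK))
  refine Filter.tendsto_atTop_mono' _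
    ((eventually_mem_levels ha).mono fun K hK => log_le_returnTime ha hK) ?_
  refine Filter.Tendsto.atTop_div_const (mul_pos hb hD) (Real.tendsto_log_atTop.comp ?_)
  refine Filter.tendsto_atTop_add_const_left _ _ ?_
  simp only [div_eq_mul_inv]
  exact (tendsto_inv_nhdsGT_zero.comp hη).const_mul_atTop hD

theorem tendsto_of_returnTime_le (ha : √3 < a) {F : ℝ → ℝ}
    (hF : ∀ K ∈ Set.Ioo (minLevel a) (figureEightLevel a), 3 / 2 * returnTime a K ≤ F K) :
    Filter.Tendsto F (𝓝[<] (figureEightLevel a)) Filter.atTop :=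
  Filter.tendsto_atTop_mono' _ ((eventually_mem_levels ha).mono hF)
    ((tendsto_returnTime ha).const_mul_atTop (by norm_num))

/-- A continuous function on an interval which is unbounded above at the right end is not constant
modulo `2π`. -/
theorem exists_sub_ne_two_pi {F : ℝ → ℝ} {l k : ℝ} (hlk : l < k)
    (hF : ContinuousOn F (Set.Ioo l k)) (hlim : Filter.Tendsto F (𝓝[<] k) Filter.atTop) :
    ∃ K₁ ∈ Set.Ioo l k, ∃ K₂ ∈ Set.Ioo l k, ∀ n : ℤ, F K₁ - F K₂ ≠ n * (2 * Real.pi) := by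
  obtain ⟨K₂, hK₂⟩ := Set.nonempty_Ioo.2 hlk
  obtain ⟨K, hK, hKF⟩ := ((Filter.Eventually.and (Ioo_mem_nhdsLT hlk)
    (hlim.eventually_ge_atTop (F K₂ + 1)))).exists
  -- The intermediate value theorem gives levels whose values differ by exactly `1`, which is not a
  -- multiple of `2π`.
  obtain ⟨K₁, hK₁, h⟩ := isPreconnected_Ioo.intermediate_value hK₂ hK hF
    (⟨by linarith, hKF⟩ : F K₂ + 1 ∈ Set.Icc (F K₂) (F K))
  refine ⟨K₁, hK₁, K₂, hK₂, fun n hn => ?_⟩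
  have h1 : (n : ℝ) * (2 * Real.pi) = 1 := by linarith
  have hpi := Real.pi_gt_three
  rcases le_or_gt n 0 with h0 | h0
  · have : (n : ℝ) ≤ 0 := by exact_mod_cast h0
    nlinarith
  · have : (1 : ℝ) ≤ n := by exact_mod_cast h0
    nlinarith

/-! ### Reduced curves on a level -/

variable {M : ℝ → Fin 3 → ℝ}

theorem exists_isReducedCurve (ha : √3 < a)
    (hK : K ∈ Set.Ioo (minLevel a) (figureEightLevel a)) : ∃ M, IsReducedCurve a K M := by
  -- Compactness of one period supplies the global bound required by `exists_phase`.
  obtain ⟨B, hB⟩ := (isCompact_Icc (a := (0 : ℝ)) (b := 2 * Real.pi)).bddAbove_image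
    (continuous_phaseSpeed a K).continuousOn
  have hB' : ∀ x, phaseSpeed a K x ≤ B := fun x => by
    obtain ⟨y, hy, hxy⟩ := (phaseSpeed_periodic a K).exists_mem_Ico₀ Real.two_pi_pos x
    rw [hxy]
    exact hB ⟨y, Set.Ico_subset_Icc_self hy, rfl⟩
  obtain ⟨φ, hφ⟩ := exists_phase (continuous_phaseSpeed a K) (phaseSpeed_pos ha hK) hB'
  exact ⟨_, isReducedCurve_curvePoint ha hK hφ⟩

/-- The phase is strictly increasing and gains `2π` in this time, and no two phases closer than `2π`
give the same point, so no earlier return is possible. -/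
theorem IsReducedCurve.isLeast_returnTime (h : IsReducedCurve a K M) (ha : √3 < a)
    (hK : K ∈ Set.Ioo (minLevel a) (figureEightLevel a)) :
    IsLeast {t : ℝ | 0 < t ∧ M t = M 0} (returnTime a K) := by
  obtain ⟨ε, hε, φ, hφ, hM⟩ := h.exists_phase ha hK
  have hret : φ (returnTime a K) = φ 0 + 2 * Real.pi :=
    phase_return (continuous_phaseSpeed a K) (phaseSpeed_pos ha hK) (phaseSpeed_periodic a K) hφ
  have hmono := strictMono_of_hasDerivAt_pos (phaseSpeed_pos ha hK) hφ
  refine ⟨⟨returnTime_pos ha hK, ?_⟩, fun t ht => ?_⟩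
  · rw [hM, hM, hret, curvePoint_periodic]
  · rw [← hmono.le_iff_le, hret]
    exact add_two_pi_le_of_curvePoint_eq ha (amplitude_pos hK.1) hε (hmono ht.1)
      (by rw [← hM, ← hM, ht.2])

/-- Over a full turn, time integrals of functions of `M₃` are integrals over the phase. -/
theorem IsReducedCurve.integral_eq (h : IsReducedCurve a K M) (ha : √3 < a)
    (hK : K ∈ Set.Ioo (minLevel a) (figureEightLevel a)) {F : ℝ → ℝ}
    (hF : Continuous fun φ => F (height a (amplitude a K) φ)) :
    ∫ t in (0 : ℝ)..returnTime a K, F (M t 2) =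
      ∫ φ in (0 : ℝ)..2 * Real.pi, F (height a (amplitude a K) φ) / phaseSpeed a K φ := by
  obtain ⟨ε, hε, φ, hφ, hM⟩ := h.exists_phase ha hK
  have h2 : ∀ t, M t 2 = height a (amplitude a K) (φ t) := fun t => by
    rw [hM]; simp [curvePoint]
  simp only [h2]
  exact integral_comp_phase_period (continuous_phaseSpeed a K) (phaseSpeed_pos ha hK)
    (phaseSpeed_periodic a K) hφ hF fun φ => by simp only [height_periodic a _ φ]

theorem IsReducedCurve.dynamicTerm_eq (h : IsReducedCurve a K M) (ha : √3 < a)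
    (hK : K ∈ Set.Ioo (minLevel a) (figureEightLevel a)) :
    levelDynamicTerm a K = dynamicTerm a K M (returnTime a K) := by
  have ha0 := pos_of_sqrt_three_lt ha
  rw [levelDynamicTerm, ← h.integral_eq ha hK (F := fun z => 3 / 2 * z + cConst a)
    (by have := continuous_height a (amplitude a K); fun_prop), dynamicTerm]
  congr 1
  refine intervalIntegral.integral_congr fun t _ => ?_
  have hH := h.lightlike t
  rw [hamiltonian_eq ha0.ne'] at hH
  linarith

theorem IsReducedCurve.levelHolonomy_eq (h : IsReducedCurve a K M) (ha : √3 < a)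
    (hK : K ∈ Set.Ioo (minLevel a) (figureEightLevel a)) :
    levelHolonomy a K = ∫ t in (0 : ℝ)..returnTime a K, rotationSpeed a (√K) (M t 2) :=
  (h.integral_eq ha hK (continuous_rotationSpeed_height ha hK)).symm

end

end ChainsSU2

theorem mainTheorem2 (a : ℝ) (ha : √3 < a) :
    ChainsSU2.minLevel a < ChainsSU2.figureEightLevel a ∧
    ∃ T dyn Δθ : ℝ → ℝ,
      (∀ K ∈ Set.Ioo (ChainsSU2.minLevel a) (ChainsSU2.figureEightLevel a),
        (∃ g γ M P, ChainsSU2.IsLightlikeGeodesic a K g γ M P) ∧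
        ∀ (g : ℝ → ChainsSU2.SU2) (γ : ℝ → ℝ) (M : ℝ → Fin 3 → ℝ) (P : ℝ → ℝ),
          ChainsSU2.IsLightlikeGeodesic a K g γ M P →
            IsLeast {t : ℝ | 0 < t ∧ M t = M 0} (T K) ∧
            (∀ δ : ℝ, ChainsSU2.IsHolonomy g M (T K) δ ↔
              ∃ n : ℤ, δ = Δθ K + n * (4 * Real.pi)) ∧
            dyn K = ChainsSU2.dynamicTerm a K M (T K) ∧
            Δθ K = dyn K - ChainsSU2.solidAngle (√K) M (T K)) ∧
      ContinuousOn Δθ (Set.Ioo (ChainsSU2.minLevel a) (ChainsSU2.figureEightLevel a)) ∧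
      Filter.Tendsto T (𝓝[<] (ChainsSU2.figureEightLevel a)) Filter.atTop ∧
      Filter.Tendsto dyn (𝓝[<] (ChainsSU2.figureEightLevel a)) Filter.atTop ∧
      Filter.Tendsto Δθ (𝓝[<] (ChainsSU2.figureEightLevel a)) Filter.atTop ∧
      ∃ K₁ ∈ Set.Ioo (ChainsSU2.minLevel a) (ChainsSU2.figureEightLevel a),
        ∃ K₂ ∈ Set.Ioo (ChainsSU2.minLevel a) (ChainsSU2.figureEightLevel a),
          ∀ n : ℤ, Δθ K₁ - Δθ K₂ ≠ n * (2 * Real.pi) := by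
  open ChainsSU2 in
  refine ⟨minLevel_lt_figureEightLevel ha, returnTime a, levelDynamicTerm a, levelHolonomy a,
    fun K hK => ⟨?_, fun g γ M P h => ?_⟩, continuousOn_levelHolonomy ha, tendsto_returnTime ha,
    tendsto_of_returnTime_le ha fun K hK => returnTime_le_levelDynamicTerm ha hK,
    tendsto_of_returnTime_le ha fun K hK => returnTime_le_levelHolonomy ha hK,
    exists_sub_ne_two_pi (minLevel_lt_figureEightLevel ha) (continuousOn_levelHolonomy ha)
      (tendsto_of_returnTime_le ha fun K hK => returnTime_le_levelHolonomy ha hK)⟩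
  · obtain ⟨M, hM⟩ := exists_isReducedCurve ha hK
    exact hM.exists_geodesic ha hK
  · have hM := h.isReducedCurve (pos_of_sqrt_three_lt ha).ne'
    have hT := hM.isLeast_returnTime ha hK
    refine ⟨hT, fun δ => ?_, hM.dynamicTerm_eq ha hK, ?_⟩
    · rw [hM.levelHolonomy_eq ha hK]
      exact h.isHolonomy_iff ha hK hT.1.2 δ
    · rw [hM.levelHolonomy_eq ha hK, hM.dynamicTerm_eq ha hK]
      exact hM.integral_rotationSpeed ha hK _
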